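/- Let $m\in\mathbb N$ and $p>2$, let $\mathbb D^2$ be the open unit disc in $\mathbb R^2$, and let $|\cdot|$ denote the Euclidean (Frobenius) norm on $\mathbb R^2\otimes M_m(\mathbb R)$. Let $f\in L^{p/(p-2)}(\mathbb D^2)$ with $f\ge 1$ a.e., and let $\Omega=(\Omega_1,\Omega_2)\in L^2(\mathbb D^2,\mathbb R^2\otimes so(m))$ satisfy $$\int_{\mathbb D^2} f\,|\Omega|^2\,dx^2<+\infty .$$ Let $W^{1,2}_f(\mathbb D^2,SO(m))$ be the set of $Q\in W^{1,2}(\mathbb D^2,M_m(\mathbb R))$ such that $Q(x)\in SO(m)$ for a.e. $x$ and $\int_{\mathbb D^2} f\,|\nabla Q|^2\,dx^2<+\infty$; the condition $Q=Id$ on $\partial\mathbb D^2$ means $Q-Id\in W^{1,2}_0(\mathbb D^2,M_m(\mathbb R))$. Put $$E_f(\Omega):=\inf\Big\{\int_{\mathbb D^2} f\,|Q\,\Omega-\nabla Q|^2\,dx^2\ :\ Q\in W^{1,2}_f(\mathbb D^2,SO(m)),\ Q=Id\ \text{on}\ \partial\mathbb D^2\Big\}.$$ Then there exists $Q\in W^{1,2}_f(\mathbb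 D^2,SO(m))$ with $Q=Id$ on $\partial\mathbb D^2$ that attains this infimum, that is, $\int_{\mathbb D^2} f\,|Q\,\Omega-\nabla Q|^2\,dx^2=E_f(\Omega)$, and that satisfies the following. The field $f\,(Q\,\Omega\,Q^{-1}-\nabla Q\,Q^{-1})$ is locally integrable on $\mathbb D^2$, $$\operatorname{div}\big(f\,(Q\,\Omega\,Q^{-1}-\nabla Q\,Q^{-1})\big)=0\quad\text{in }\mathcal D'(\mathbb D^2),$$ and $$\int_{\mathbb D^2} f\,|Q\,\Omega-\nabla Q|^2\,dx^2\le\int_{\mathbb D^2} f\,|\Omega|^2\,dx^2 .$$ -/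

import Mathlib

open MeasureTheory Filter Topology
open scoped ENNReal Distributions

noncomputable section

namespace GaugeExtraction

/-- The Euclidean plane. -/
abbrev Plane : Type := EuclideanSpace ℝ (Fin 2)

/-- The open unit disc of the plane. -/
def disc : TopologicalSpace.Opens Plane := ⟨Metric.ball 0 1, Metric.isOpen_ball⟩

/-- Lebesgue measure on the unit disc. -/
def discMeasure : Measure Plane := volume.restrict (disc : Set Plane)

/-- The classical partial derivative of `φ` in the coordinate direction `α`. -/
def partialDeriv (α : Fin 2) (φ : Plane → ℝ) (x : Plane) : ℝ :=
  fderiv ℝ φ x (EuclideanSpace.single α 1)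

/-- `u ∈ W^{1,2}(disc)`, with weak gradient `g = (g 0, g 1)`: the function and its weak partial
derivatives are square integrable, the latter being characterized by integration by parts against
`C^∞` functions with compact support in the open disc. -/
structure IsW12 (u : Plane → ℝ) (g : Fin 2 → Plane → ℝ) : Prop where
  memLp : MemLp u 2 discMeasure
  memLp_grad : ∀ α, MemLp (g α) 2 discMeasure
  weak_deriv : ∀ (α : Fin 2) (φ : 𝓓(disc, ℝ)),
    ∫ x, u x * partialDeriv α φ x ∂discMeasure = -∫ x, g α x * φ x ∂discMeasure

/-- `u`, with weak gradient `g`, has zero boundary values: it belongs to `W^{1,2}_0(disc)`, the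
closure in `W^{1,2}(disc)` of the `C^∞` functions with compact support in the open disc. -/
def IsW12Zero (u : Plane → ℝ) (g : Fin 2 → Plane → ℝ) : Prop :=
  IsW12 u g ∧ ∃ φ : ℕ → 𝓓(disc, ℝ),
    Tendsto (fun k => eLpNorm (fun x => φ k x - u x) 2 discMeasure) atTop (𝓝 0) ∧
    ∀ α, Tendsto (fun k => eLpNorm (fun x => partialDeriv α (φ k) x - g α x) 2 discMeasure)
      atTop (𝓝 0)

variable {m : ℕ}

/-- The squared Euclidean norm `|A|² = ∑_α ∑_{i,j} (A_α)_{ij}²` on `ℝ² ⊗ M_m(ℝ)`. -/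
def normSq (A : Fin 2 → Matrix (Fin m) (Fin m) ℝ) : ℝ :=
  ∑ α, ∑ i, ∑ j, (A α i j) ^ 2

/-- `Ω ∈ L²(disc, ℝ² ⊗ so(m))`. -/
def IsL2so (Ω : Plane → Fin 2 → Matrix (Fin m) (Fin m) ℝ) : Prop :=
  (∀ α i j, MemLp (fun x => Ω x α i j) 2 discMeasure) ∧
    ∀ᵐ x ∂discMeasure, ∀ α, Ω x α ∈ LieAlgebra.Orthogonal.so (Fin m) ℝ

/-- `Q ∈ W^{1,2}(disc, SO(m))`, with weak gradient `dQ`. -/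
def IsW12SO (Q : Plane → Matrix (Fin m) (Fin m) ℝ)
    (dQ : Plane → Fin 2 → Matrix (Fin m) (Fin m) ℝ) : Prop :=
  (∀ i j, IsW12 (fun x => Q x i j) (fun α x => dQ x α i j)) ∧
    ∀ᵐ x ∂discMeasure, Q x ∈ Matrix.specialOrthogonalGroup (Fin m) ℝ

/-- `Q = Id` on the boundary of the disc, in the Sobolev sense `Q - Id ∈ W^{1,2}_0`
(`dQ` is the weak gradient of `Q`, hence of `Q - Id`). -/
def EqIdOnBoundary (Q : Plane → Matrix (Fin m) (Fin m) ℝ)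
    (dQ : Plane → Fin 2 → Matrix (Fin m) (Fin m) ℝ) : Prop :=
  ∀ i j, IsW12Zero (fun x => Q x i j - (1 : Matrix (Fin m) (Fin m) ℝ) i j)
    (fun α x => dQ x α i j)

/-- The integral `∫ f |A|²` over the disc, for a weight `f ≥ 0`, as an element of `[0, ∞]`. -/
def weightedEnergy (f : Plane → ℝ) (A : Plane → Fin 2 → Matrix (Fin m) (Fin m) ℝ) : ℝ≥0∞ :=
  ∫⁻ x, ENNReal.ofReal (f x * normSq (A x)) ∂discMeasure

/-- The competitors: `Q ∈ W^{1,2}_f(disc, SO(m))`, that is `Q ∈ W^{1,2}(disc, SO(m))` with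
`∫ f |∇Q|² < ∞`, such that `Q = Id` on the boundary. Here `dQ` is the weak gradient of `Q`. -/
structure IsAdmissible (f : Plane → ℝ) (Q : Plane → Matrix (Fin m) (Fin m) ℝ)
    (dQ : Plane → Fin 2 → Matrix (Fin m) (Fin m) ℝ) : Prop where
  isW12SO : IsW12SO Q dQ
  energy_lt_top : weightedEnergy f dQ < ⊤
  boundary : EqIdOnBoundary Q dQ

/-- The functional `∫ f |Q Ω - ∇Q|²`, where `dQ` is the weak gradient of `Q`. -/
def gaugeEnergy (f : Plane → ℝ) (Ω : Plane → Fin 2 → Matrix (Fin m) (Fin m) ℝ)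
    (Q : Plane → Matrix (Fin m) (Fin m) ℝ)
    (dQ : Plane → Fin 2 → Matrix (Fin m) (Fin m) ℝ) : ℝ≥0∞ :=
  weightedEnergy f (fun x α => Q x * Ω x α - dQ x α)

/-- `E_f(Ω)`, the infimum of `∫ f |Q Ω - ∇Q|²` over all competitors. -/
def gaugeInf (f : Plane → ℝ) (Ω : Plane → Fin 2 → Matrix (Fin m) (Fin m) ℝ) : ℝ≥0∞ :=
  ⨅ (Q : Plane → Matrix (Fin m) (Fin m) ℝ) (dQ : Plane → Fin 2 → Matrix (Fin m) (Fin m) ℝ)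
    (_ : IsAdmissible f Q dQ), gaugeEnergy f Ω Q dQ

/-- `div V = 0` in the sense of distributions on the disc, entry by entry, for a locally integrable
field `V` with values in `ℝ² ⊗ M_m(ℝ)`. -/
def DivEqZero (V : Plane → Fin 2 → Matrix (Fin m) (Fin m) ℝ) : Prop :=
  (∀ α i j, LocallyIntegrableOn (fun x => V x α i j) (disc : Set Plane) volume) ∧
    ∀ (i j : Fin m) (φ : 𝓓(disc, ℝ)),
      ∫ x, ∑ α, V x α i j * partialDeriv α φ x ∂discMeasure = 0

end GaugeExtraction

end

/-!
The energy `Q ↦ ∫ f |Q Ω - ∇Q|²` is minimised by the direct method, and the divergence equation is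
the Euler-Lagrange equation of the minimiser.

*Existence* (`exists_minimizer`). Since `|Q Ω| = |Ω|`, a minimising sequence `Q_k` has `√f ∇Q_k`
bounded in `L²`, so along a subsequence `Q_k - 1` and `√f ∇Q_k` converge weakly in `L²`. As
`f ≥ 1`, the first sequence is bounded in `W^{1,2}_0`, and Rellich's theorem (`rellich`) makes its
convergence strong, hence a.e. along a further subsequence; the limit therefore takes values in
`SO(m)`. The boundary condition survives because `W^{1,2}_0` is weakly closed
(`IsW12Zero.of_tendstoWeakly`), and the energy of the limit is at most the infimum by weak lower
semicontinuity of the norm (`TendstoWeakly.sum_integral_sq_le`). Comparison with `Q = 1` bounds the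
infimum by `∫ f |Ω|²`.

Rellich's theorem is proved with the Fourier transform: weak convergence of functions supported in
the disc gives pointwise convergence of their transforms, which handles bounded frequencies by
dominated convergence, and the gradient bound makes high frequencies uniformly small.

*Euler-Lagrange equation* (`divEqZero_of_minimizer`). For a test function `φ` and `A = E_ij - E_ji`
the competitors `exp (t φ A) Q` have energy exactly `∫ f |Q Ω - ∇Q - t ∇φ A Q|²`, because the
rotation commutes with `A` and drops out of the norm. Its derivative at `t = 0` vanishes, which says
that the skew part of `V = (Q Ω - ∇Q) Qᵀ` satisfies `div (f V) = 0`. Finally `V` is itself skew,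
since `Q Ω Qᵀ` is and since `Q Qᵀ = 1` can be differentiated
(`IsAdmissible.grad_mul_transpose_skew`).
-/

open scoped ContDiff SchwartzMap FourierTransform LineDeriv

namespace GaugeExtraction

/-! ### Weak convergence in `L²` -/

section

variable {X : Type*} [MeasurableSpace X] {μ : Measure X}

/-- Weak convergence in `L²(μ)` of a sequence of real functions: convergence of the pairings with
all square integrable functions. Only meaningful when `u k` and `w` are themselves in `L²(μ)`,
which is kept as a separate hypothesis. -/
def TendstoWeakly (μ : Measure X) (u : ℕ → X → ℝ) (w : X → ℝ) : Prop :=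
  ∀ v : X → ℝ, MemLp v 2 μ →
    Tendsto (fun k => ∫ x, u k x * v x ∂μ) atTop (𝓝 (∫ x, w x * v x ∂μ))

theorem inner_toLp_eq_integral {u v : X → ℝ} (hu : MemLp u 2 μ) (hv : MemLp v 2 μ) :
    inner ℝ (hu.toLp u) (hv.toLp v) = ∫ x, u x * v x ∂μ := by
  rw [L2.inner_def]
  refine integral_congr_ae ?_
  filter_upwards [hu.coeFn_toLp, hv.coeFn_toLp] with x h1 h2
  rw [h1, h2]
  simp [mul_comm]

theorem norm_toLp_sq_eq_integral {u : X → ℝ} (hu : MemLp u 2 μ) :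
    ‖hu.toLp u‖ ^ 2 = ∫ x, u x ^ 2 ∂μ := by
  rw [← real_inner_self_eq_norm_sq, inner_toLp_eq_integral]
  simp only [pow_two]

theorem integrable_mul_of_memLp_two {u v : X → ℝ} (hu : MemLp u 2 μ) (hv : MemLp v 2 μ) :
    Integrable (fun x => u x * v x) μ := hu.integrable_mul hv

/-- Bounded families of sequences in `L²` have a common weakly convergent subsequence: sequential
Banach-Alaoglu in the Hilbert sum of finitely many copies of `L²`. -/
theorem exists_subseq_tendstoWeakly [IsSeparable μ] [SFinite μ] {ι : Type*} [Fintype ι]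
    (u : ℕ → ι → X → ℝ) (hu : ∀ k i, MemLp (u k i) 2 μ) (C : ℝ)
    (hC : ∀ k i, ∫ x, u k i x ^ 2 ∂μ ≤ C) :
    ∃ σ : ℕ → ℕ, StrictMono σ ∧ ∃ w : ι → X → ℝ, ∀ i, MemLp (w i) 2 μ ∧
      TendstoWeakly μ (fun k => u (σ k) i) (w i) := by
  classical
  have : Fact ((2 : ℝ≥0∞) ≠ ⊤) := ⟨by norm_num⟩
  let H := PiLp 2 (fun _ : ι => Lp ℝ 2 μ)
  have : SecondCountableTopology H := inferInstanceAs
    (SecondCountableTopology (PiLp 2 (fun _ : ι => Lp ℝ 2 μ)))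
  let z : ℕ → H := fun k => WithLp.toLp 2 (fun i => (hu k i).toLp (u k i))
  have hz : ∀ k, ‖z k‖ ≤ √(Fintype.card ι * C) := by
    intro k
    apply Real.le_sqrt_of_sq_le
    rw [PiLp.norm_sq_eq_of_L2]
    calc ∑ i, ‖(z k) i‖ ^ 2 ≤ ∑ _i : ι, C := Finset.sum_le_sum fun i _ =>
          (norm_toLp_sq_eq_integral (hu k i)).trans_le (hC k i)
      _ = _ := by simp
  have hcomp := WeakDual.isSeqCompact_closedBall ℝ H (0 : StrongDual ℝ H) (√(Fintype.card ι * C))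
  let ℓ : ℕ → WeakDual ℝ H := fun k =>
    StrongDual.toWeakDual (InnerProductSpace.toDual ℝ H (z k))
  obtain ⟨a, -, σ, hσ, ha⟩ := hcomp (x := ℓ) (fun k => by simpa [ℓ] using hz k)
  let w : H := (InnerProductSpace.toDual ℝ H).symm (WeakDual.toStrongDual a)
  refine ⟨σ, hσ, fun i => (w i : X → ℝ), fun i => ⟨Lp.memLp _, fun v hv => ?_⟩⟩
  have h1 := (WeakBilin.tendsto_iff_forall_eval_tendsto _
    (ContinuousLinearMap.coe_injective)).1 ha
    (PiLp.single 2 i (hv.toLp v))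
  have e1 : ∀ y : H, inner ℝ y (PiLp.single 2 i (hv.toLp v)) = inner ℝ (y i) (hv.toLp v) := by
    intro y
    rw [PiLp.inner_apply, Finset.sum_eq_single i]
    · simp
    · intro j _ hj; simp [hj]
    · simp
  have e2 : inner ℝ (w i) (hv.toLp v) = ∫ x, w i x * v x ∂μ := by
    rw [← inner_toLp_eq_integral (Lp.memLp _) hv, Lp.toLp_coeFn]
  have e3 : a (PiLp.single 2 i (hv.toLp v)) = inner ℝ w (PiLp.single 2 i (hv.toLp v)) := by
    simp [w]
  rw [← e2, ← e1, ← e3]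
  refine h1.congr fun k => ?_
  change inner ℝ (z (σ k)) (PiLp.single 2 i (hv.toLp v)) = _
  rw [e1, ← inner_toLp_eq_integral (hu (σ k) i) hv]

/-- Weak lower semicontinuity of the `L²` norm, for a finite family of functions. -/
theorem TendstoWeakly.sum_integral_sq_le {ι : Type*} [Fintype ι] {u : ℕ → ι → X → ℝ}
    {w : ι → X → ℝ} (hu : ∀ k i, MemLp (u k i) 2 μ) (hw : ∀ i, MemLp (w i) 2 μ)
    (h : ∀ i, TendstoWeakly μ (fun k => u k i) (w i)) {E : ℕ → ℝ} {e : ℝ}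
    (hE : ∀ k, ∑ i, ∫ x, u k i x ^ 2 ∂μ ≤ E k) (he : Tendsto E atTop (𝓝 e)) :
    ∑ i, ∫ x, w i x ^ 2 ∂μ ≤ e := by
  have h1 : Tendsto (fun k => 2 * ∑ i, ∫ x, u k i x * w i x ∂μ) atTop
      (𝓝 (2 * ∑ i, ∫ x, w i x * w i x ∂μ)) :=
    (tendsto_finsetSum _ fun i _ => h i (w i) (hw i)).const_mul 2
  have h2 : ∀ k, 2 * ∑ i, ∫ x, u k i x * w i x ∂μ ≤ E k + ∑ i, ∫ x, w i x ^ 2 ∂μ := by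
    intro k
    -- `2 ⟨u_k, w⟩ ≤ ‖u_k‖² + ‖w‖²`, componentwise
    refine le_trans ?_ (add_le_add_left (hE k) _)
    rw [Finset.mul_sum, ← Finset.sum_add_distrib]
    refine Finset.sum_le_sum fun i _ => ?_
    rw [← integral_const_mul, ← integral_add (hu k i).integrable_sq (hw i).integrable_sq]
    refine integral_mono ((integrable_mul_of_memLp_two (hu k i) (hw i)).const_mul 2)
      ((hu k i).integrable_sq.add (hw i).integrable_sq) fun x => ?_
    have := two_mul_le_add_sq (u k i x) (w i x)
    simp only
    linarith
  have h3 := le_of_tendsto_of_tendsto' h1 (he.add_const _) h2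
  simp only [← pow_two] at h3
  linarith

theorem TendstoWeakly.comp {u : ℕ → X → ℝ} {w : X → ℝ} (h : TendstoWeakly μ u w) {σ : ℕ → ℕ}
    (hσ : StrictMono σ) : TendstoWeakly μ (fun k => u (σ k)) w :=
  fun v hv => (h v hv).comp hσ.tendsto_atTop

theorem tendsto_eLpNorm_iff_integral_sq {u : ℕ → X → ℝ} (hu : ∀ k, MemLp (u k) 2 μ) :
    Tendsto (fun k => eLpNorm (u k) 2 μ) atTop (𝓝 0) ↔
      Tendsto (fun k => ∫ x, u k x ^ 2 ∂μ) atTop (𝓝 0) := by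
  have e : ∀ k, eLpNorm (u k) 2 μ = ENNReal.ofReal (√(∫ x, u k x ^ 2 ∂μ)) := by
    intro k
    rw [← norm_toLp_sq_eq_integral (hu k), Real.sqrt_sq (norm_nonneg _), Lp.norm_toLp,
      ENNReal.ofReal_toReal (hu k).2.ne]
  constructor
  · intro h
    have h2 := (ENNReal.tendsto_toReal (ENNReal.zero_ne_top)).comp h
    have h3 := h2.pow 2
    simp only [ENNReal.toReal_zero, ne_eq, OfNat.ofNat_ne_zero, not_false_eq_true, zero_pow] at h3
    refine h3.congr fun k => ?_
    simp only [Function.comp, e]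
    rw [ENNReal.toReal_ofReal (Real.sqrt_nonneg _),
      Real.sq_sqrt (integral_nonneg fun x => sq_nonneg _)]
  · intro h
    simp only [e]
    simpa using ENNReal.tendsto_ofReal (h.sqrt)

theorem abs_integral_mul_le {u v : X → ℝ} (hu : MemLp u 2 μ) (hv : MemLp v 2 μ) :
    |∫ x, u x * v x ∂μ| ≤ √(∫ x, u x ^ 2 ∂μ) * √(∫ x, v x ^ 2 ∂μ) := by
  rw [← inner_toLp_eq_integral hu hv, ← norm_toLp_sq_eq_integral hu,
    ← norm_toLp_sq_eq_integral hv, Real.sqrt_sq (norm_nonneg _), Real.sqrt_sq (norm_nonneg _)]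
  exact abs_real_inner_le_norm _ _

theorem tendstoWeakly_of_tendsto_eLpNorm {u : ℕ → X → ℝ} {w : X → ℝ}
    (hu : ∀ k, MemLp (u k) 2 μ) (hw : MemLp w 2 μ)
    (h : Tendsto (fun k => eLpNorm (fun x => u k x - w x) 2 μ) atTop (𝓝 0)) :
    TendstoWeakly μ u w := by
  intro v hv
  have h2 := (tendsto_eLpNorm_iff_integral_sq (fun k => (hu k).sub hw)).1 h
  rw [tendsto_iff_norm_sub_tendsto_zero]
  refine squeeze_zero (fun _ => norm_nonneg _) (fun k => ?_)
    (g := fun k => √(∫ x, (u k x - w x) ^ 2 ∂μ) * √(∫ x, v x ^ 2 ∂μ)) ?_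
  · rw [← integral_sub (integrable_mul_of_memLp_two (hu k) hv) (integrable_mul_of_memLp_two hw hv)]
    simpa only [sub_mul, Real.norm_eq_abs, Pi.sub_apply] using
      abs_integral_mul_le ((hu k).sub hw) hv
  · simpa using h2.sqrt.mul_const (√(∫ x, v x ^ 2 ∂μ))

end

/-! ### Test functions and their Fourier transforms -/

section

instance : IsFiniteMeasure discMeasure := by
  unfold discMeasure
  exact ⟨by simp [disc]⟩

theorem measurableSet_disc : MeasurableSet (disc : Set Plane) := disc.isOpen.measurableSet

theorem contDiff_partialDeriv {φ : Plane → ℝ} (h : ContDiff ℝ ∞ φ) (α : Fin 2) :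
    ContDiff ℝ ∞ (partialDeriv α φ) :=
  (h.fderiv_right (m := ∞) le_rfl).clm_apply contDiff_const

theorem tsupport_partialDeriv_subset (φ : Plane → ℝ) (α : Fin 2) :
    tsupport (partialDeriv α φ) ⊆ tsupport φ := tsupport_fderiv_apply_subset ℝ _

theorem hasCompactSupport_partialDeriv {φ : Plane → ℝ} (h : HasCompactSupport φ) (α : Fin 2) :
    HasCompactSupport (partialDeriv α φ) := h.fderiv_apply ℝ _

/-- The partial derivative of a test function, as a test function. -/
noncomputable def dTest (α : Fin 2) (φ : 𝓓(disc, ℝ)) : 𝓓(disc, ℝ) where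
  toFun := partialDeriv α φ
  contDiff' := contDiff_partialDeriv φ.contDiff α
  hasCompactSupport' := hasCompactSupport_partialDeriv φ.hasCompactSupport α
  tsupport_subset' := (tsupport_partialDeriv_subset _ α).trans φ.tsupport_subset

@[simp] theorem dTest_apply (α : Fin 2) (φ : 𝓓(disc, ℝ)) (x : Plane) :
    dTest α φ x = partialDeriv α φ x := rfl

theorem memLp_test (φ : 𝓓(disc, ℝ)) (p : ℝ≥0∞) : MemLp φ p discMeasure :=
  (φ.continuous.memLp_of_hasCompactSupport φ.hasCompactSupport).restrict _

theorem memLp_partialDeriv (φ : 𝓓(disc, ℝ)) (α : Fin 2) (p : ℝ≥0∞) :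
    MemLp (partialDeriv α φ) p discMeasure := memLp_test (dTest α φ) p

theorem exists_bound_test (φ : 𝓓(disc, ℝ)) : ∃ C, ∀ x, |φ x| ≤ C :=
  φ.continuous.bounded_above_of_compact_support φ.hasCompactSupport

theorem test_eq_zero (φ : 𝓓(disc, ℝ)) {x : Plane} (hx : x ∉ (disc : Set Plane)) : φ x = 0 :=
  image_eq_zero_of_notMem_tsupport fun h => hx (φ.tsupport_subset h)

theorem setIntegral_disc_eq {E : Type*} [NormedAddCommGroup E] [NormedSpace ℝ E] {g : Plane → E}
    (h : ∀ x ∉ (disc : Set Plane), g x = 0) : ∫ x, g x ∂discMeasure = ∫ x, g x :=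
  setIntegral_eq_integral_of_forall_compl_eq_zero h

theorem differentiable_test (φ : 𝓓(disc, ℝ)) : Differentiable ℝ φ :=
  φ.contDiff.differentiable (by simp)

theorem partialDeriv_sub_test (φ ψ : 𝓓(disc, ℝ)) (α : Fin 2) (x : Plane) :
    partialDeriv α (φ - ψ : 𝓓(disc, ℝ)) x = partialDeriv α φ x - partialDeriv α ψ x := by
  unfold partialDeriv
  rw [FunLike.coe_sub, fderiv_sub (differentiable_test φ x) (differentiable_test ψ x)]
  rfl

/-- A test function as a complex-valued Schwartz function on the plane. -/
noncomputable def testToSchwartz (φ : 𝓓(disc, ℝ)) : 𝓢(Plane, ℂ) :=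
  HasCompactSupport.toSchwartzMap (f := fun x => (φ x : ℂ))
    (φ.hasCompactSupport.comp_left (g := ((↑) : ℝ → ℂ)) (by simp))
    (Complex.ofRealCLM.contDiff.comp φ.contDiff)

@[simp] theorem testToSchwartz_apply (φ : 𝓓(disc, ℝ)) (x : Plane) :
    testToSchwartz φ x = (φ x : ℂ) := rfl

theorem integral_norm_sq_fourier_test (φ : 𝓓(disc, ℝ)) :
    ∫ ξ, ‖𝓕 (testToSchwartz φ) ξ‖ ^ 2 = ∫ x, φ x ^ 2 ∂discMeasure := by
  rw [SchwartzMap.integral_norm_sq_fourier, setIntegral_disc_eq]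
  · simp
  · intro x hx; simp [test_eq_zero φ hx]

theorem lineDeriv_testToSchwartz (φ : 𝓓(disc, ℝ)) (α : Fin 2) :
    ∂_{(EuclideanSpace.single α (1 : ℝ) : Plane)} (testToSchwartz φ) =
      testToSchwartz (dTest α φ) := by
  ext x
  rw [SchwartzMap.lineDerivOp_apply, ]
  have h1 : HasFDerivAt (fun x => (φ x : ℂ))
      (Complex.ofRealCLM.comp (fderiv ℝ φ x)) x :=
    Complex.ofRealCLM.hasFDerivAt.comp x (differentiable_test φ x).hasFDerivAt
  have h2 := (h1.hasLineDerivAt (EuclideanSpace.single α (1 : ℝ))).lineDeriv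
  exact h2

theorem norm_sq_fourier_dTest (φ : 𝓓(disc, ℝ)) (α : Fin 2) (ξ : Plane) :
    ‖𝓕 (testToSchwartz (dTest α φ)) ξ‖ ^ 2 =
      (2 * Real.pi) ^ 2 * (ξ α) ^ 2 * ‖𝓕 (testToSchwartz φ) ξ‖ ^ 2 := by
  rw [← lineDeriv_testToSchwartz, SchwartzMap.fourier_lineDerivOp_eq]
  have : (inner ℝ · (EuclideanSpace.single α (1 : ℝ) : Plane)).HasTemperateGrowth :=
    ((innerSL ℝ).flip _).hasTemperateGrowth
  rw [smul_apply, SchwartzMap.smulLeftCLM_apply_apply this]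
  simp [mul_pow, EuclideanSpace.inner_single_right, abs_of_pos Real.pi_pos]
  ring

theorem integrable_norm_sq_schwartz (F : 𝓢(Plane, ℂ)) : Integrable (fun ξ => ‖F ξ‖ ^ 2) :=
  (F.memLp 2).integrable_norm_pow (by norm_num)

/-- The `L²` mass that a test function has at frequencies at least `R` is at most `R⁻²` times its
Dirichlet energy. The factor `(2π)²` from the convention for `𝓕` is dropped. -/
theorem integral_sq_le_low_frequency (φ : 𝓓(disc, ℝ)) {R : ℝ} (hR : 0 < R) :
    ∫ x, φ x ^ 2 ∂discMeasure ≤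
      (∫ ξ in Metric.ball 0 R, ‖𝓕 (testToSchwartz φ) ξ‖ ^ 2) +
        R⁻¹ ^ 2 * ∑ α, ∫ x, partialDeriv α φ x ^ 2 ∂discMeasure := by
  have e : ∀ α, ∫ x, partialDeriv α φ x ^ 2 ∂discMeasure =
      ∫ ξ, ‖𝓕 (testToSchwartz (dTest α φ)) ξ‖ ^ 2 := fun α =>
    (integral_norm_sq_fourier_test (dTest α φ)).symm
  rw [← integral_norm_sq_fourier_test, ← integral_indicator Metric.isOpen_ball.measurableSet]
  simp only [e]
  rw [← integral_finsetSum _ fun α _ => integrable_norm_sq_schwartz _, ← integral_const_mul,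
    ← integral_add]
  · refine integral_mono (integrable_norm_sq_schwartz _) ?_ fun ξ => ?_
    · exact ((integrable_norm_sq_schwartz _).indicator Metric.isOpen_ball.measurableSet).add
        ((integrable_finsetSum _ fun α _ => integrable_norm_sq_schwartz _).const_mul _)
    · simp only [norm_sq_fourier_dTest]
      set a := ‖𝓕 (testToSchwartz φ) ξ‖ ^ 2 with ha
      have ha0 : 0 ≤ a := by positivity
      by_cases hξ : ξ ∈ Metric.ball (0 : Plane) R
      · rw [Set.indicator_of_mem hξ]
        have : 0 ≤ R⁻¹ ^ 2 * ∑ α, (2 * Real.pi) ^ 2 * (ξ α) ^ 2 * a := by positivity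
        linarith
      · rw [Set.indicator_of_notMem hξ, zero_add]
        have h1 : R ^ 2 ≤ ∑ α, (ξ α) ^ 2 := by
          have : R ≤ ‖ξ‖ := by simpa using hξ
          calc R ^ 2 ≤ ‖ξ‖ ^ 2 := by gcongr
            _ = _ := by simp [EuclideanSpace.real_norm_sq_eq]
        have h2 : (1 : ℝ) ≤ (2 * Real.pi) ^ 2 := by nlinarith [Real.pi_gt_three]
        calc a = R⁻¹ ^ 2 * (1 * R ^ 2 * a) := by field_simp
          _ ≤ R⁻¹ ^ 2 * ((2 * Real.pi) ^ 2 * (∑ α, (ξ α) ^ 2) * a) := by gcongr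
          _ = _ := by simp only [Finset.mul_sum, Finset.sum_mul]
  · exact (integrable_norm_sq_schwartz _).indicator Metric.isOpen_ball.measurableSet
  · exact (integrable_finsetSum _ fun α _ => integrable_norm_sq_schwartz _).const_mul _

theorem testToSchwartz_sub (φ ψ : 𝓓(disc, ℝ)) :
    testToSchwartz (φ - ψ) = testToSchwartz φ - testToSchwartz ψ := by
  ext x; simp

theorem fourier_testToSchwartz_apply (φ : 𝓓(disc, ℝ)) (ξ : Plane) :
    𝓕 (testToSchwartz φ) ξ =
      ((∫ x, φ x * Real.cos (2 * Real.pi * inner ℝ x ξ) ∂discMeasure : ℝ) : ℂ) -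
      ((∫ x, φ x * Real.sin (2 * Real.pi * inner ℝ x ξ) ∂discMeasure : ℝ) : ℂ) * Complex.I := by
  have hc : Continuous fun x : Plane => Real.cos (2 * Real.pi * inner ℝ x ξ) := by fun_prop
  have hs : Continuous fun x : Plane => Real.sin (2 * Real.pi * inner ℝ x ξ) := by fun_prop
  rw [SchwartzMap.fourier_coe, Real.fourier_eq, setIntegral_disc_eq, setIntegral_disc_eq]
  · rw [← integral_complex_ofReal, ← integral_complex_ofReal, ← integral_mul_const, ← integral_sub]
    · refine integral_congr_ae (.of_forall fun x => ?_)
      simp only [Circle.smul_def, Real.fourierChar_apply, testToSchwartz_apply, smul_eq_mul,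
        Complex.exp_mul_I]
      push_cast
      simp only [mul_neg, Complex.cos_neg, Complex.sin_neg]
      ring
    · exact ((φ.continuous.mul hc).integrable_of_hasCompactSupport
        φ.hasCompactSupport.mul_right).ofReal
    · exact (((φ.continuous.mul hs).integrable_of_hasCompactSupport
        φ.hasCompactSupport.mul_right).ofReal).mul_const _
  · intro x hx; simp [test_eq_zero φ hx]
  · intro x hx; simp [test_eq_zero φ hx]

theorem norm_fourier_testToSchwartz_le (φ : 𝓓(disc, ℝ)) (ξ : Plane) :
    ‖𝓕 (testToSchwartz φ) ξ‖ ≤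
      √(∫ x, φ x ^ 2 ∂discMeasure) * √(∫ _x, (1 : ℝ) ^ 2 ∂discMeasure) := by
  have h := abs_integral_mul_le (memLp_test φ 2).norm (memLp_const (μ := discMeasure) (1 : ℝ))
  refine le_trans ?_ ((le_abs_self _).trans (by simpa using h))
  · rw [SchwartzMap.fourier_coe, Real.fourier_eq, setIntegral_disc_eq]
    · refine (norm_integral_le_integral_norm _).trans (le_of_eq ?_)
      simp [Circle.norm_smul]
    · intro x hx; simp [test_eq_zero φ hx]

theorem exists_tendsto_fourier {φ : ℕ → 𝓓(disc, ℝ)} {u : Plane → ℝ}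
    (h : TendstoWeakly discMeasure (fun k => φ k) u) (ξ : Plane) :
    ∃ z : ℂ, Tendsto (fun k => 𝓕 (testToSchwartz (φ k)) ξ) atTop (𝓝 z) := by
  have hc : MemLp (fun x : Plane => Real.cos (2 * Real.pi * inner ℝ x ξ)) 2 discMeasure :=
    MemLp.of_bound (by fun_prop) 1 (.of_forall fun x => Real.abs_cos_le_one _)
  have hs : MemLp (fun x : Plane => Real.sin (2 * Real.pi * inner ℝ x ξ)) 2 discMeasure :=
    MemLp.of_bound (by fun_prop) 1 (.of_forall fun x => Real.abs_sin_le_one _)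
  simp only [fourier_testToSchwartz_apply]
  exact ⟨_, ((Complex.continuous_ofReal.tendsto _).comp (h _ hc)).sub
    (((Complex.continuous_ofReal.tendsto _).comp (h _ hs)).mul_const _)⟩

end

/-! ### Rellich's theorem -/

section

/-- Weak convergence of functions supported in the disc gives pointwise convergence of the Fourier
transforms, hence `L²` convergence on bounded sets of frequencies. -/
theorem tendsto_low_frequency {φ : ℕ → 𝓓(disc, ℝ)} {u : Plane → ℝ}
    (h : TendstoWeakly discMeasure (fun k => φ k) u) {C : ℝ}
    (hC : ∀ k, ∫ x, φ k x ^ 2 ∂discMeasure ≤ C) (R : ℝ) :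
    Tendsto (fun p : ℕ × ℕ =>
      ∫ ξ in Metric.ball 0 R, ‖𝓕 (testToSchwartz (φ p.1 - φ p.2)) ξ‖ ^ 2) atTop (𝓝 0) := by
  set B := √C * √(∫ _x, (1 : ℝ) ^ 2 ∂discMeasure) with hB
  have hb : ∀ k ξ, ‖𝓕 (testToSchwartz (φ k)) ξ‖ ≤ B := fun k ξ =>
    (norm_fourier_testToSchwartz_le _ _).trans
      (mul_le_mul_of_nonneg_right (Real.sqrt_le_sqrt (hC k)) (Real.sqrt_nonneg _))
  have e : ∀ k l ξ, 𝓕 (testToSchwartz (φ k - φ l)) ξ =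
      𝓕 (testToSchwartz (φ k)) ξ - 𝓕 (testToSchwartz (φ l)) ξ := by
    intro k l ξ
    rw [testToSchwartz_sub, sub_eq_add_neg, FourierTransform.fourier_add,
      FourierTransform.fourier_neg, ← sub_eq_add_neg, sub_apply]
  have key := tendsto_integral_filter_of_dominated_convergence
    (μ := volume.restrict (Metric.ball (0 : Plane) R)) (l := (atTop : Filter (ℕ × ℕ)))
    (F := fun p ξ => ‖𝓕 (testToSchwartz (φ p.1 - φ p.2)) ξ‖ ^ 2) (f := fun _ => 0)
    (fun _ => (B + B) ^ 2) ?_ ?_ ?_ ?_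
  · simpa using key
  · exact .of_forall fun p => (integrable_norm_sq_schwartz _).aestronglyMeasurable.restrict
  · refine .of_forall fun p => .of_forall fun ξ => ?_
    rw [Real.norm_of_nonneg (by positivity), e]
    gcongr
    exact (norm_sub_le _ _).trans (add_le_add (hb _ _) (hb _ _))
  · exact integrable_const_iff.2 (.inr ⟨by
      simpa only [Measure.restrict_apply_univ] using measure_ball_lt_top⟩)
  · refine .of_forall fun ξ => ?_
    obtain ⟨z, hz⟩ := exists_tendsto_fourier h ξ
    simp only [e]
    rw [← prod_atTop_atTop_eq]
    have := ((hz.comp (tendsto_fst (g := atTop))).sub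
      (hz.comp (tendsto_snd (f := atTop)))).norm.pow 2
    simpa using this

theorem integral_sub_sq_le {X : Type*} [MeasurableSpace X] {μ : Measure X} {u v : X → ℝ}
    (hu : MemLp u 2 μ) (hv : MemLp v 2 μ) :
    ∫ x, (u x - v x) ^ 2 ∂μ ≤ 2 * ∫ x, u x ^ 2 ∂μ + 2 * ∫ x, v x ^ 2 ∂μ := by
  rw [← integral_const_mul, ← integral_const_mul,
    ← integral_add (hu.integrable_sq.const_mul 2) (hv.integrable_sq.const_mul 2)]
  refine integral_mono (hu.sub hv).integrable_sq
    ((hu.integrable_sq.const_mul 2).add (hv.integrable_sq.const_mul 2)) fun x => ?_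
  nlinarith [sq_nonneg (u x + v x)]

/-- Rellich's theorem for test functions, as a Cauchy property. -/
theorem tendsto_integral_sq_sub_test {φ : ℕ → 𝓓(disc, ℝ)} {u : Plane → ℝ}
    (h : TendstoWeakly discMeasure (fun k => φ k) u) {C : ℝ}
    (hC : ∀ k, ∫ x, φ k x ^ 2 ∂discMeasure ≤ C)
    (hC' : ∀ k α, ∫ x, partialDeriv α (φ k) x ^ 2 ∂discMeasure ≤ C) :
    Tendsto (fun p : ℕ × ℕ => ∫ x, (φ p.1 x - φ p.2 x) ^ 2 ∂discMeasure) atTop (𝓝 0) := by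
  have hC0 : 0 ≤ C := (integral_nonneg fun x => sq_nonneg (φ 0 x)).trans (hC 0)
  have hgrad : ∀ k l, ∑ α, ∫ x, partialDeriv α (φ k - φ l : 𝓓(disc, ℝ)) x ^ 2 ∂discMeasure
      ≤ 8 * C := by
    intro k l
    have : ∀ α, ∫ x, partialDeriv α (φ k - φ l : 𝓓(disc, ℝ)) x ^ 2 ∂discMeasure ≤ 4 * C := by
      intro α
      simp only [partialDeriv_sub_test]
      have := integral_sub_sq_le (memLp_partialDeriv (φ k) α 2) (memLp_partialDeriv (φ l) α 2)
      linarith [hC' k α, hC' l α]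
    rw [Fin.sum_univ_two]
    linarith [this 0, this 1]
  rw [Metric.tendsto_nhds]
  intro ε hε
  obtain ⟨R, hR, hRε⟩ : ∃ R : ℝ, 0 < R ∧ R⁻¹ ^ 2 * (8 * C) < ε / 2 := by
    have : Tendsto (fun R : ℝ => R⁻¹ ^ 2 * (8 * C)) atTop (𝓝 0) := by
      simpa using (tendsto_inv_atTop_zero.pow 2).mul_const (8 * C)
    obtain ⟨R, h1, h2⟩ := ((this.eventually (gt_mem_nhds (half_pos hε))).and
      (eventually_gt_atTop 0)).exists
    exact ⟨R, h2, h1⟩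
  filter_upwards [(tendsto_low_frequency h hC R).eventually (gt_mem_nhds (half_pos hε))] with p hp
  rw [Real.dist_0_eq_abs, abs_of_nonneg (integral_nonneg fun x => sq_nonneg _)]
  have h1 := integral_sq_le_low_frequency (φ p.1 - φ p.2) hR
  have h2 := mul_le_mul_of_nonneg_left (hgrad p.1 p.2) (sq_nonneg R⁻¹)
  simp only [sub_apply] at h1
  linarith

/-- A weakly convergent sequence that is Cauchy for the `L²` norm converges strongly. -/
theorem TendstoWeakly.tendsto_of_cauchy {X : Type*} [MeasurableSpace X] {μ : Measure X}
    {u : ℕ → X → ℝ} {w : X → ℝ} (h : TendstoWeakly μ u w) (hu : ∀ k, MemLp (u k) 2 μ)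
    (hw : MemLp w 2 μ)
    (hc : Tendsto (fun p : ℕ × ℕ => ∫ x, (u p.1 x - u p.2 x) ^ 2 ∂μ) atTop (𝓝 0)) :
    Tendsto (fun k => ∫ x, (u k x - w x) ^ 2 ∂μ) atTop (𝓝 0) := by
  rw [Metric.tendsto_nhds]
  intro ε hε
  rw [← prod_atTop_atTop_eq] at hc
  have h1 := (hc.eventually (ge_mem_nhds (half_pos hε))).curry
  filter_upwards [h1] with k hk
  rw [Real.dist_0_eq_abs, abs_of_nonneg (integral_nonneg fun x => sq_nonneg _)]
  refine lt_of_le_of_lt ?_ (half_lt_self hε)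
  -- lower semicontinuity of the norm along `l ↦ u k - u l`
  obtain ⟨N, hN⟩ := eventually_atTop.1 hk
  have := TendstoWeakly.sum_integral_sq_le (ι := Unit) (μ := μ)
    (u := fun l _ x => u k x - u (l + N) x) (w := fun _ x => u k x - w x)
    (fun l _ => (hu k).sub (hu _)) (fun _ => (hu k).sub hw) ?_ (E := fun _ => ε / 2) (e := ε / 2)
    ?_ tendsto_const_nhds
  · simpa using this
  · intro _ v hv
    have h2 := ((tendsto_add_atTop_iff_nat N).2 (h v hv)).const_sub (∫ x, u k x * v x ∂μ)
    simp only [sub_mul]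
    rw [integral_sub (integrable_mul_of_memLp_two (hu k) hv) (integrable_mul_of_memLp_two hw hv)]
    refine h2.congr fun l => ?_
    rw [integral_sub (integrable_mul_of_memLp_two (hu k) hv)
      (integrable_mul_of_memLp_two (hu _) hv)]
  · intro l
    simpa using hN (l + N) (Nat.le_add_left _ _)

theorem integral_sq_le_of_eLpNorm_le_one {X : Type*} [MeasurableSpace X] {μ : Measure X}
    {u : X → ℝ} (hu : MemLp u 2 μ) (h : eLpNorm u 2 μ ≤ 1) : ∫ x, u x ^ 2 ∂μ ≤ 1 := by
  rw [← norm_toLp_sq_eq_integral hu, Lp.norm_toLp]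
  refine pow_le_one₀ ENNReal.toReal_nonneg ?_
  simpa using ENNReal.toReal_mono ENNReal.one_ne_top h

/-- **Rellich's theorem** in sequential form: a sequence bounded in `W^{1,2}_0` of the disc that
converges weakly in `L²` converges strongly. -/
theorem rellich {u : ℕ → Plane → ℝ} {g : ℕ → Fin 2 → Plane → ℝ} {w : Plane → ℝ}
    (hu : ∀ k, IsW12Zero (u k) (g k)) (hw : MemLp w 2 discMeasure)
    (h : TendstoWeakly discMeasure u w) {C : ℝ}
    (hC : ∀ k, ∫ x, u k x ^ 2 ∂discMeasure ≤ C)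
    (hC' : ∀ k α, ∫ x, g k α x ^ 2 ∂discMeasure ≤ C) :
    Tendsto (fun k => eLpNorm (fun x => u k x - w x) 2 discMeasure) atTop (𝓝 0) := by
  have huL : ∀ k, MemLp (u k) 2 discMeasure := fun k => (hu k).1.memLp
  have hgL : ∀ k α, MemLp (g k α) 2 discMeasure := fun k => (hu k).1.memLp_grad
  have hex : ∀ k : ℕ, ∃ φ : 𝓓(disc, ℝ),
      eLpNorm (fun x => φ x - u k x) 2 discMeasure ≤ ENNReal.ofReal (1 / ((k : ℝ) + 1)) ∧
      ∀ α, eLpNorm (fun x => partialDeriv α φ x - g k α x) 2 discMeasure ≤ 1 := by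
    intro k
    obtain ⟨ψ, h1, h2⟩ := (hu k).2
    have hpos : (0 : ℝ≥0∞) < ENNReal.ofReal (1 / ((k : ℝ) + 1)) := by
      rw [ENNReal.ofReal_pos]; positivity
    have h3 := (h1.eventually (ge_mem_nhds hpos)).and
      (eventually_all.2 fun α => (h2 α).eventually (ge_mem_nhds one_pos))
    obtain ⟨n, h4, h5⟩ := h3.exists
    exact ⟨ψ n, h4, h5⟩
  choose φ hφ hφ' using hex
  have hd : ∀ k, MemLp (fun x => φ k x - u k x) 2 discMeasure :=
    fun k => (memLp_test (φ k) 2).sub (huL k)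
  have hφu : Tendsto (fun k => eLpNorm (fun x => φ k x - u k x) 2 discMeasure) atTop (𝓝 0) := by
    refine tendsto_of_tendsto_of_tendsto_of_le_of_le tendsto_const_nhds ?_ (fun _ => zero_le) hφ
    simpa using ENNReal.tendsto_ofReal (tendsto_one_div_add_atTop_nhds_zero_nat (𝕜 := ℝ))
  -- the approximating test functions inherit the weak limit and the bounds
  have hφw : TendstoWeakly discMeasure (fun k => φ k) w := by
    intro v hv
    have h1 := tendstoWeakly_of_tendsto_eLpNorm hd (MemLp.zero (μ := discMeasure) (ε := ℝ))
      (by simpa using hφu) v hv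
    have h2 := h1.add (h v hv)
    simp only [Pi.zero_apply, zero_mul, integral_zero, zero_add] at h2
    refine h2.congr fun k => ?_
    rw [← integral_add (integrable_mul_of_memLp_two (hd k) hv)
      (integrable_mul_of_memLp_two (huL k) hv)]
    simp only [sub_mul, sub_add_cancel]
  have h1 : ∀ k, ∫ x, φ k x ^ 2 ∂discMeasure ≤ 2 + 2 * C := by
    intro k
    have h2 := integral_sub_sq_le (hd k) (huL k).neg
    have h3 := integral_sq_le_of_eLpNorm_le_one (hd k) ((hφ k).trans (by
      rw [ENNReal.ofReal_le_one, div_le_one (by positivity)]; linarith [k.cast_nonneg (α := ℝ)]))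
    simp only [Pi.neg_apply, sub_neg_eq_add, sub_add_cancel, neg_sq] at h2
    linarith [hC k]
  have h2 : ∀ k α, ∫ x, partialDeriv α (φ k) x ^ 2 ∂discMeasure ≤ 2 + 2 * C := by
    intro k α
    have hdα := (memLp_partialDeriv (φ k) α 2).sub (hgL k α)
    have h2 := integral_sub_sq_le hdα (hgL k α).neg
    have h3 := integral_sq_le_of_eLpNorm_le_one hdα (hφ' k α)
    simp only [Pi.neg_apply, Pi.sub_apply, sub_neg_eq_add, sub_add_cancel, neg_sq] at h2 h3
    linarith [hC' k α]
  have h3 := hφw.tendsto_of_cauchy (fun k => memLp_test (φ k) 2) hw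
    (tendsto_integral_sq_sub_test hφw h1 h2)
  have h4 := (tendsto_eLpNorm_iff_integral_sq fun k => (memLp_test (φ k) 2).sub hw).2 h3
  have h5 := h4.add hφu
  rw [add_zero] at h5
  refine tendsto_of_tendsto_of_tendsto_of_le_of_le tendsto_const_nhds h5 (fun _ => zero_le)
    fun k => ?_
  have h6 := eLpNorm_sub_le (p := 2) ((memLp_test (φ k) 2).sub hw).aestronglyMeasurable
    (hd k).aestronglyMeasurable (by norm_num)
  refine le_trans (le_of_eq ?_) h6
  congr 1
  ext x
  simp

end

/-! ### Calculus in `W^{1,2}` and `W^{1,2}_0` -/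

section

/-- The product of two test functions, as a test function. -/
noncomputable def mulTest (η φ : 𝓓(disc, ℝ)) : 𝓓(disc, ℝ) where
  toFun x := η x * φ x
  contDiff' := η.contDiff.mul φ.contDiff
  hasCompactSupport' := φ.hasCompactSupport.mul_left
  tsupport_subset' := (tsupport_mul_subset_right).trans φ.tsupport_subset

@[simp] theorem mulTest_apply (η φ : 𝓓(disc, ℝ)) (x : Plane) : mulTest η φ x = η x * φ x := rfl

theorem partialDeriv_mulTest (η φ : 𝓓(disc, ℝ)) (α : Fin 2) (x : Plane) :
    partialDeriv α (mulTest η φ) x = η x * partialDeriv α φ x + partialDeriv α η x * φ x := by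
  unfold partialDeriv
  change (fderiv ℝ (fun y => η y * φ y) x) _ = _
  rw [fderiv_fun_mul (differentiable_test η x) (differentiable_test φ x)]
  simp [mul_comm]

theorem partialDeriv_add_test (φ ψ : 𝓓(disc, ℝ)) (α : Fin 2) (x : Plane) :
    partialDeriv α (φ + ψ : 𝓓(disc, ℝ)) x = partialDeriv α φ x + partialDeriv α ψ x := by
  unfold partialDeriv
  rw [FunLike.coe_add, fderiv_add (differentiable_test φ x) (differentiable_test ψ x)]
  rfl

theorem partialDeriv_smul_test (c : ℝ) (φ : 𝓓(disc, ℝ)) (α : Fin 2) (x : Plane) :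
    partialDeriv α (c • φ : 𝓓(disc, ℝ)) x = c * partialDeriv α φ x := by
  unfold partialDeriv
  rw [FunLike.coe_smul, fderiv_const_smul (differentiable_test φ x)]
  rfl

theorem partialDeriv_zero_test (α : Fin 2) (x : Plane) :
    partialDeriv α (0 : 𝓓(disc, ℝ)) x = 0 := by
  unfold partialDeriv
  simp

theorem memLp_mul_test {v : Plane → ℝ} (hv : MemLp v 2 discMeasure) (η : 𝓓(disc, ℝ)) :
    MemLp (fun x => η x * v x) 2 discMeasure :=
  hv.mul (memLp_test η ∞)

theorem integral_partialDeriv_test (φ : 𝓓(disc, ℝ)) (α : Fin 2) :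
    ∫ x, partialDeriv α φ x ∂discMeasure = 0 := by
  rw [setIntegral_disc_eq (g := partialDeriv α φ) fun x hx => test_eq_zero (dTest α φ) hx]
  have hi : Integrable (fun x => fderiv ℝ φ x (EuclideanSpace.single α 1))
      (volume : Measure Plane) :=
    (dTest α φ).continuous.integrable_of_hasCompactSupport (dTest α φ).hasCompactSupport
  have h := integral_mul_fderiv_eq_neg_fderiv_mul_of_integrable (μ := (volume : Measure Plane))
    (f := fun _ => (1 : ℝ)) (g := φ) (v := EuclideanSpace.single α 1)
    (by simp) (by simpa only [one_mul] using hi)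
    (by simpa using φ.continuous.integrable_of_hasCompactSupport φ.hasCompactSupport)
    (by simp) (fun x _ => differentiable_test φ x)
  simpa [partialDeriv] using h

theorem IsW12.const (c : ℝ) : IsW12 (fun _ => c) (fun _ _ => 0) where
  memLp := memLp_const c
  memLp_grad _ := memLp_const 0
  weak_deriv α φ := by simp [integral_const_mul, integral_partialDeriv_test]

variable {u v : Plane → ℝ} {g h : Fin 2 → Plane → ℝ}

theorem IsW12.add (hu : IsW12 u g) (hv : IsW12 v h) :
    IsW12 (fun x => u x + v x) (fun α x => g α x + h α x) where
  memLp := hu.memLp.add hv.memLp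
  memLp_grad α := (hu.memLp_grad α).add (hv.memLp_grad α)
  weak_deriv α φ := by
    have h1 := memLp_partialDeriv φ α 2
    have h2 := memLp_test φ 2
    simp only [add_mul]
    rw [integral_add (integrable_mul_of_memLp_two hu.memLp h1)
      (integrable_mul_of_memLp_two hv.memLp h1),
      integral_add (integrable_mul_of_memLp_two (hu.memLp_grad α) h2)
      (integrable_mul_of_memLp_two (hv.memLp_grad α) h2), hu.weak_deriv, hv.weak_deriv]
    ring

/-- Leibniz rule for the product of a Sobolev function with a test function. -/
theorem IsW12.mul_test (hu : IsW12 u g) (η : 𝓓(disc, ℝ)) :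
    IsW12 (fun x => η x * u x) (fun α x => η x * g α x + partialDeriv α η x * u x) where
  memLp := memLp_mul_test hu.memLp η
  memLp_grad α := (memLp_mul_test (hu.memLp_grad α) η).add (memLp_mul_test hu.memLp (dTest α η))
  weak_deriv α φ := by
    have h1 := hu.weak_deriv α (mulTest η φ)
    have i1 := integrable_mul_of_memLp_two hu.memLp (memLp_partialDeriv (mulTest η φ) α 2)
    have i2 := integrable_mul_of_memLp_two hu.memLp (memLp_test (mulTest (dTest α η) φ) 2)
    have i3 := integrable_mul_of_memLp_two (hu.memLp_grad α) (memLp_test (mulTest η φ) 2)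
    calc ∫ x, η x * u x * partialDeriv α φ x ∂discMeasure
        = ∫ x, (u x * partialDeriv α (mulTest η φ) x - u x * mulTest (dTest α η) φ x)
            ∂discMeasure := by
          refine integral_congr_ae (.of_forall fun x => ?_)
          simp only [partialDeriv_mulTest, mulTest_apply, dTest_apply]
          ring
      _ = -∫ x, (g α x * mulTest η φ x + u x * mulTest (dTest α η) φ x) ∂discMeasure := by
          rw [integral_sub i1 i2, h1, integral_add i3 i2]
          ring
      _ = _ := by
          congr 1
          refine integral_congr_ae (.of_forall fun x => ?_)
          simp only [mulTest_apply, dTest_apply]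
          ring

theorem isW12_test (φ : 𝓓(disc, ℝ)) : IsW12 φ (fun α => partialDeriv α φ) := by
  refine ⟨memLp_test φ 2, fun α => memLp_partialDeriv φ α 2, fun α ψ => ?_⟩
  have h1 := integral_partialDeriv_test (mulTest φ ψ) α
  simp only [partialDeriv_mulTest] at h1
  rw [integral_add (integrable_mul_of_memLp_two (memLp_test φ 2) (memLp_partialDeriv ψ α 2))
    (integrable_mul_of_memLp_two (memLp_partialDeriv φ α 2) (memLp_test ψ 2))] at h1
  linarith

theorem isW12Zero_test (φ : 𝓓(disc, ℝ)) : IsW12Zero φ (fun α => partialDeriv α φ) :=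
  ⟨isW12_test φ, fun _ => φ, by simp, by simp⟩

theorem isW12Zero_zero : IsW12Zero (fun _ => 0) (fun _ _ => 0) := by
  have h := isW12Zero_test 0
  have e : (fun α => partialDeriv α (0 : 𝓓(disc, ℝ))) = fun _ _ => 0 := by
    ext α x; exact partialDeriv_zero_test α x
  rw [e] at h
  exact h

theorem tendsto_eLpNorm_add {X : Type*} [MeasurableSpace X] {μ : Measure X}
    {a b : ℕ → X → ℝ} (ha : ∀ k, MemLp (a k) 2 μ) (hb : ∀ k, MemLp (b k) 2 μ)
    (h1 : Tendsto (fun k => eLpNorm (a k) 2 μ) atTop (𝓝 0))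
    (h2 : Tendsto (fun k => eLpNorm (b k) 2 μ) atTop (𝓝 0)) :
    Tendsto (fun k => eLpNorm (fun x => a k x + b k x) 2 μ) atTop (𝓝 0) := by
  have h3 := h1.add h2
  rw [add_zero] at h3
  exact tendsto_of_tendsto_of_tendsto_of_le_of_le tendsto_const_nhds h3 (fun _ => zero_le)
    fun k => eLpNorm_add_le (ha k).1 (hb k).1 (by norm_num)

theorem tendsto_eLpNorm_mul_test (η : 𝓓(disc, ℝ)) {a : ℕ → Plane → ℝ}
    (h : Tendsto (fun k => eLpNorm (a k) 2 discMeasure) atTop (𝓝 0)) :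
    Tendsto (fun k => eLpNorm (fun x => η x * a k x) 2 discMeasure) atTop (𝓝 0) := by
  obtain ⟨C, hC⟩ := exists_bound_test η
  have h2 : Tendsto (fun k => ENNReal.ofReal C * eLpNorm (a k) 2 discMeasure) atTop (𝓝 0) := by
    simpa using ENNReal.Tendsto.const_mul h (.inr ENNReal.ofReal_ne_top)
  refine tendsto_of_tendsto_of_tendsto_of_le_of_le tendsto_const_nhds h2 (fun _ => zero_le)
    fun k => ?_
  refine eLpNorm_le_mul_eLpNorm_of_ae_le_mul (.of_forall fun x => ?_) _
  rw [norm_mul]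
  exact mul_le_mul_of_nonneg_right (hC x) (norm_nonneg _)

theorem IsW12Zero.add (hu : IsW12Zero u g) (hv : IsW12Zero v h) :
    IsW12Zero (fun x => u x + v x) (fun α x => g α x + h α x) := by
  obtain ⟨hu, φ, h1, h2⟩ := hu
  obtain ⟨hv, ψ, h3, h4⟩ := hv
  refine ⟨hu.add hv, fun k => φ k + ψ k, ?_, fun α => ?_⟩
  · refine (tendsto_eLpNorm_add (fun k => (memLp_test (φ k) 2).sub hu.memLp)
      (fun k => (memLp_test (ψ k) 2).sub hv.memLp) h1 h3).congr fun k => ?_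
    congr 1; ext x; simp; ring
  · refine (tendsto_eLpNorm_add (fun k => (memLp_partialDeriv (φ k) α 2).sub (hu.memLp_grad α))
      (fun k => (memLp_partialDeriv (ψ k) α 2).sub (hv.memLp_grad α)) (h2 α) (h4 α)).congr
      fun k => ?_
    congr 1; ext x; simp only [partialDeriv_add_test, Pi.sub_apply]; ring

theorem IsW12Zero.mul_test (hu : IsW12Zero u g) (η : 𝓓(disc, ℝ)) :
    IsW12Zero (fun x => η x * u x) (fun α x => η x * g α x + partialDeriv α η x * u x) := by
  obtain ⟨hu, φ, h1, h2⟩ := hu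
  refine ⟨hu.mul_test η, fun k => mulTest η (φ k), ?_, fun α => ?_⟩
  · refine (tendsto_eLpNorm_mul_test η h1).congr fun k => ?_
    congr 1; ext x; simp; ring
  · have d1 := fun k => (memLp_test (φ k) 2).sub hu.memLp
    have d2 := fun k => (memLp_partialDeriv (φ k) α 2).sub (hu.memLp_grad α)
    refine (tendsto_eLpNorm_add (fun k => memLp_mul_test (d2 k) η)
      (fun k => memLp_mul_test (d1 k) (dTest α η)) (tendsto_eLpNorm_mul_test η (h2 α))
      (tendsto_eLpNorm_mul_test (dTest α η) h1)).congr fun k => ?_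
    congr 1; ext x; simp [partialDeriv_mulTest]; ring

theorem IsW12Zero.sum {ι : Type*} (s : Finset ι) {u : ι → Plane → ℝ}
    {g : ι → Fin 2 → Plane → ℝ} (h : ∀ i, IsW12Zero (u i) (g i)) :
    IsW12Zero (fun x => ∑ i ∈ s, u i x) (fun α x => ∑ i ∈ s, g i α x) := by
  classical
  induction s using Finset.induction_on with
  | empty => simpa using isW12Zero_zero
  | insert i s hi ih => simpa only [Finset.sum_insert hi] using (h i).add ih

/-- Leibniz rule for a product `u v` of Sobolev functions, `u` being constant on the boundary.
No boundedness is needed since the identity is only tested against smooth functions. -/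
theorem integral_mul_partialDeriv {c : ℝ} (hu : IsW12Zero (fun x => u x - c) g)
    (hv : IsW12 v h) (α : Fin 2) (φ : 𝓓(disc, ℝ)) :
    ∫ x, u x * v x * partialDeriv α φ x ∂discMeasure =
      -∫ x, (g α x * v x + u x * h α x) * φ x ∂discMeasure := by
  obtain ⟨hu, ψ, h1, h2⟩ := hu
  have a1 := memLp_mul_test hv.memLp (dTest α φ)
  have a2 := memLp_mul_test (hv.memLp_grad α) φ
  have a3 := memLp_mul_test hv.memLp φ
  have t1 := tendstoWeakly_of_tendsto_eLpNorm (fun k => memLp_test (ψ k) 2) hu.memLp h1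
  have t2 := tendstoWeakly_of_tendsto_eLpNorm (fun k => memLp_partialDeriv (ψ k) α 2)
    (hu.memLp_grad α) (h2 α)
  have key : ∫ x, (u x - c) * (dTest α φ x * v x) ∂discMeasure =
      -∫ x, g α x * (φ x * v x) ∂discMeasure - ∫ x, (u x - c) * (φ x * h α x) ∂discMeasure := by
    refine tendsto_nhds_unique (t1 _ a1) (((t2 _ a3).neg.sub (t1 _ a2)).congr fun k => ?_)
    have h3 := (hv.mul_test (ψ k)).weak_deriv α φ
    have h5 : ∫ x, (ψ k x * h α x + partialDeriv α (ψ k) x * v x) * φ x ∂discMeasure =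
        ∫ x, partialDeriv α (ψ k) x * (φ x * v x) ∂discMeasure +
          ∫ x, ψ k x * (φ x * h α x) ∂discMeasure := by
      rw [← integral_add (integrable_mul_of_memLp_two (memLp_partialDeriv (ψ k) α 2) a3)
        (integrable_mul_of_memLp_two (memLp_test (ψ k) 2) a2)]
      exact integral_congr_ae (.of_forall fun x => by simp only; ring)
    have h6 : ∫ x, ψ k x * (dTest α φ x * v x) ∂discMeasure =
        ∫ x, ψ k x * v x * partialDeriv α φ x ∂discMeasure :=
      integral_congr_ae (.of_forall fun x => by simp only [dTest_apply]; ring)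
    simp only [h6]
    linarith
  have h4 := hv.weak_deriv α φ
  have i1 := integrable_mul_of_memLp_two hu.memLp a1
  have i2 := integrable_mul_of_memLp_two hv.memLp (memLp_partialDeriv φ α 2)
  have i3 := integrable_mul_of_memLp_two (hu.memLp_grad α) a3
  have i4 := integrable_mul_of_memLp_two hu.memLp a2
  have i5 := integrable_mul_of_memLp_two (hv.memLp_grad α) (memLp_test φ 2)
  have i6 : Integrable (fun x => (u x - c) * (φ x * h α x) + c * (h α x * φ x)) discMeasure :=
    i4.add (i5.const_mul c)
  calc _ = ∫ x, ((u x - c) * (dTest α φ x * v x) + c * (v x * partialDeriv α φ x))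
        ∂discMeasure := integral_congr_ae (.of_forall fun x => by simp only [dTest_apply]; ring)
    _ = -∫ x, (g α x * (φ x * v x) + ((u x - c) * (φ x * h α x) + c * (h α x * φ x)))
        ∂discMeasure := by
      rw [integral_add i1 (i2.const_mul c), integral_const_mul, key, h4,
        integral_add i3 i6, integral_add i4 (i5.const_mul c),
        integral_const_mul]
      ring
    _ = _ := by
      congr 1
      exact integral_congr_ae (.of_forall fun x => by simp only; ring)

/-- The jet `(φ, ∂₀φ, ∂₁φ)` of a test function, as an element of `L² × L² × L²`. -/
noncomputable def testJet :
    𝓓(disc, ℝ) →ₗ[ℝ] PiLp 2 (fun _ : Option (Fin 2) => Lp ℝ 2 discMeasure) where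
  toFun φ := WithLp.toLp 2 fun o => o.elim ((memLp_test φ 2).toLp φ)
    fun α => (memLp_partialDeriv φ α 2).toLp (partialDeriv α φ)
  map_add' φ ψ := by
    ext1 o
    cases o with
    | none => rfl
    | some α =>
      exact (MemLp.toLp_congr (memLp_partialDeriv (φ + ψ) α 2)
        ((memLp_partialDeriv φ α 2).add (memLp_partialDeriv ψ α 2))
        (.of_forall fun x => partialDeriv_add_test φ ψ α x)).trans
        (MemLp.toLp_add (memLp_partialDeriv φ α 2) (memLp_partialDeriv ψ α 2))
  map_smul' c φ := by
    ext1 o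
    cases o with
    | none => rfl
    | some α =>
      exact (MemLp.toLp_congr (memLp_partialDeriv (c • φ) α 2)
        ((memLp_partialDeriv φ α 2).const_smul c)
        (.of_forall fun x => partialDeriv_smul_test c φ α x)).trans (MemLp.toLp_const_smul c
          (memLp_partialDeriv φ α 2))

/-- `W^{1,2}_0` is weakly sequentially closed: it is the closure of the jets of test functions, and
a closed subspace is its own double orthogonal complement. -/
theorem IsW12Zero.of_tendstoWeakly {u : ℕ → Plane → ℝ} {g : ℕ → Fin 2 → Plane → ℝ}
    {w : Plane → ℝ} {G : Fin 2 → Plane → ℝ} (hu : ∀ k, IsW12Zero (u k) (g k))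
    (hw : MemLp w 2 discMeasure) (hG : ∀ α, MemLp (G α) 2 discMeasure)
    (h : TendstoWeakly discMeasure u w)
    (h' : ∀ α, TendstoWeakly discMeasure (fun k => g k α) (G α)) : IsW12Zero w G := by
  refine ⟨⟨hw, hG, fun α φ => ?_⟩, ?_⟩
  · refine tendsto_nhds_unique (h _ (memLp_partialDeriv φ α 2)) ?_
    exact (h' α _ (memLp_test φ 2)).neg.congr fun k => ((hu k).1.weak_deriv α φ).symm
  · let z : PiLp 2 (fun _ : Option (Fin 2) => Lp ℝ 2 discMeasure) :=
      WithLp.toLp 2 fun o => o.elim (hw.toLp w) fun α => (hG α).toLp (G α)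
    have hz : z ∈ (LinearMap.range testJet).topologicalClosure := by
      rw [← Submodule.orthogonal_orthogonal_eq_closure, Submodule.mem_orthogonal']
      intro y hy
      rw [Submodule.mem_orthogonal] at hy
      have hyL : ∀ o, MemLp (y o : Plane → ℝ) 2 discMeasure := fun o => Lp.memLp _
      have e : ∀ {a : Plane → ℝ} (ha : MemLp a 2 discMeasure) (o), inner ℝ (ha.toLp a) (y o) =
          ∫ x, a x * y o x ∂discMeasure := by
        intro a ha o
        rw [← inner_toLp_eq_integral ha (hyL o), Lp.toLp_coeFn]
      have hφ : ∀ φ : 𝓓(disc, ℝ), ∫ x, φ x * y none x ∂discMeasure +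
          ∑ α, ∫ x, partialDeriv α φ x * y (some α) x ∂discMeasure = 0 := by
        intro φ
        have := hy (testJet φ) ⟨φ, rfl⟩
        rw [PiLp.inner_apply, Fintype.sum_option] at this
        rw [← e (memLp_test φ 2)]
        simp only [← e (memLp_partialDeriv φ _ 2)]
        exact this
      have huk : ∀ k, ∫ x, u k x * y none x ∂discMeasure +
          ∑ α, ∫ x, g k α x * y (some α) x ∂discMeasure = 0 := by
        intro k
        obtain ⟨hk, φ, h1, h2⟩ := hu k
        have t1 := tendstoWeakly_of_tendsto_eLpNorm (fun n => memLp_test (φ n) 2) hk.memLp h1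
        have t2 := fun α => tendstoWeakly_of_tendsto_eLpNorm
          (fun n => memLp_partialDeriv (φ n) α 2) (hk.memLp_grad α) (h2 α)
        refine tendsto_nhds_unique ((t1 _ (hyL none)).add
          (tendsto_finsetSum _ fun α _ => t2 α _ (hyL (some α)))) ?_
        simp only [hφ]
        exact tendsto_const_nhds
      have hlim : ∫ x, w x * y none x ∂discMeasure +
          ∑ α, ∫ x, G α x * y (some α) x ∂discMeasure = 0 := by
        refine tendsto_nhds_unique ((h _ (hyL none)).add
          (tendsto_finsetSum _ fun α _ => h' α _ (hyL (some α)))) ?_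
        simp only [huk]
        exact tendsto_const_nhds
      rw [PiLp.inner_apply, Fintype.sum_option]
      rw [← e hw] at hlim
      simp only [← e (hG _)] at hlim
      exact hlim
    obtain ⟨s, hs, hsz⟩ := mem_closure_iff_seq_limit.1 hz
    choose φ hφ using hs
    have hcomp : ∀ o, Tendsto (fun k => testJet (φ k) o) atTop (𝓝 (z o)) := by
      intro o
      simp only [hφ]
      exact ((PiLp.continuous_apply 2 _ o).tendsto z).comp hsz
    refine ⟨φ, ?_, fun α => ?_⟩
    · exact (Lp.tendsto_Lp_iff_tendsto_eLpNorm'' _ (fun k => memLp_test (φ k) 2) _ hw).1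
        (hcomp none)
    · exact (Lp.tendsto_Lp_iff_tendsto_eLpNorm'' _ (fun k => memLp_partialDeriv (φ k) α 2) _
        (hG α)).1 (hcomp (some α))

end

/-! ### Orthogonal matrices and weighted energies -/

section

variable {m : ℕ}

theorem sum_sq_mul_orthogonal {R : Matrix (Fin m) (Fin m) ℝ} (hR : R.transpose * R = 1)
    (A : Matrix (Fin m) (Fin m) ℝ) : ∑ i, ∑ j, (R * A) i j ^ 2 = ∑ i, ∑ j, A i j ^ 2 := by
  have h : ∀ B : Matrix (Fin m) (Fin m) ℝ, ∑ i, ∑ j, B i j ^ 2 = (B.transpose * B).trace := by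
    intro B
    rw [Finset.sum_comm]
    simp [Matrix.trace, Matrix.mul_apply, pow_two]
  rw [h, h, Matrix.transpose_mul, Matrix.mul_assoc, ← Matrix.mul_assoc R.transpose, hR,
    Matrix.one_mul]

theorem normSq_mul_orthogonal {R : Matrix (Fin m) (Fin m) ℝ} (hR : R.transpose * R = 1)
    (A : Fin 2 → Matrix (Fin m) (Fin m) ℝ) : normSq (fun α => R * A α) = normSq A := by
  simp only [normSq, sum_sq_mul_orthogonal hR]

theorem transpose_mul_self_of_mem {Q : Matrix (Fin m) (Fin m) ℝ}
    (hQ : Q ∈ Matrix.specialOrthogonalGroup (Fin m) ℝ) : Q.transpose * Q = 1 :=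
  (Matrix.mem_orthogonalGroup_iff' _ _).1 (Matrix.mem_specialOrthogonalGroup_iff.1 hQ).1

theorem mul_transpose_self_of_mem {Q : Matrix (Fin m) (Fin m) ℝ}
    (hQ : Q ∈ Matrix.specialOrthogonalGroup (Fin m) ℝ) : Q * Q.transpose = 1 :=
  (Matrix.mem_orthogonalGroup_iff _ _).1 (Matrix.mem_specialOrthogonalGroup_iff.1 hQ).1

theorem abs_entry_le_one {Q : Matrix (Fin m) (Fin m) ℝ}
    (hQ : Q ∈ Matrix.specialOrthogonalGroup (Fin m) ℝ) (i j : Fin m) : |Q i j| ≤ 1 :=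
  entry_norm_bound_of_unitary (Matrix.mem_specialOrthogonalGroup_iff.1 hQ).1 i j

theorem isClosed_specialOrthogonalGroup :
    IsClosed {A : Matrix (Fin m) (Fin m) ℝ | A ∈ Matrix.specialOrthogonalGroup (Fin m) ℝ} := by
  simp only [Matrix.mem_specialOrthogonalGroup_iff, Matrix.mem_orthogonalGroup_iff]
  exact (isClosed_eq (by fun_prop) continuous_const).inter
    (isClosed_eq (by fun_prop) continuous_const)

variable {f : Plane → ℝ}

theorem aestronglyMeasurable_sqrt (hf : AEStronglyMeasurable f discMeasure) :
    AEStronglyMeasurable (fun x => √(f x)) discMeasure :=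
  Real.continuous_sqrt.comp_aestronglyMeasurable hf

/-- The weighted energy as a sum of `L²` norms of the functions `√f A`. -/
theorem weightedEnergy_eq (hf1 : ∀ᵐ x ∂discMeasure, 1 ≤ f x)
    {A : Plane → Fin 2 → Matrix (Fin m) (Fin m) ℝ}
    (hA : ∀ α i j, MemLp (fun x => √(f x) * A x α i j) 2 discMeasure) :
    weightedEnergy f A =
      ENNReal.ofReal (∑ p : Fin 2 × Fin m × Fin m,
        ∫ x, (√(f x) * A x p.1 p.2.1 p.2.2) ^ 2 ∂discMeasure) := by
  have hi : ∀ p : Fin 2 × Fin m × Fin m,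
      Integrable (fun x => (√(f x) * A x p.1 p.2.1 p.2.2) ^ 2) discMeasure :=
    fun p => (hA _ _ _).integrable_sq
  rw [← integral_finsetSum _ fun p _ => hi p, ofReal_integral_eq_lintegral_ofReal
    (integrable_finsetSum _ fun p _ => hi p)
    (.of_forall fun x => Finset.sum_nonneg fun p _ => sq_nonneg _)]
  refine lintegral_congr_ae ?_
  filter_upwards [hf1] with x hx
  congr 1
  simp only [normSq, mul_pow, Real.sq_sqrt (zero_le_one.trans hx), Fintype.sum_prod_type,
    Finset.mul_sum]

theorem memLp_of_weightedEnergy_lt_top (hf : AEStronglyMeasurable f discMeasure)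
    (hf1 : ∀ᵐ x ∂discMeasure, 1 ≤ f x)
    {A : Plane → Fin 2 → Matrix (Fin m) (Fin m) ℝ}
    (hA : ∀ α i j, AEStronglyMeasurable (fun x => A x α i j) discMeasure)
    (h : weightedEnergy f A < ⊤) (α : Fin 2) (i j : Fin m) :
    MemLp (fun x => √(f x) * A x α i j) 2 discMeasure := by
  have hm := (aestronglyMeasurable_sqrt hf).mul (hA α i j)
  refine (memLp_two_iff_integrable_sq hm).2 ?_
  have hn : AEStronglyMeasurable (fun x => f x * normSq (A x)) discMeasure := by
    refine hf.mul ?_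
    unfold normSq
    exact Finset.aestronglyMeasurable_fun_sum _ fun α _ =>
      Finset.aestronglyMeasurable_fun_sum _ fun i _ =>
      Finset.aestronglyMeasurable_fun_sum _ fun j _ => (hA α i j).pow 2
  have hnn : ∀ᵐ x ∂discMeasure, 0 ≤ f x * normSq (A x) := by
    filter_upwards [hf1] with x hx
    have : 0 ≤ normSq (A x) := by unfold normSq; positivity
    positivity
  have hi : Integrable (fun x => f x * normSq (A x)) discMeasure :=
    (lintegral_ofReal_ne_top_iff_integrable hn hnn).1 h.ne
  refine hi.mono' (hm.pow 2) ?_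
  filter_upwards [hf1] with x hx
  rw [Real.norm_of_nonneg (sq_nonneg _)]
  change (√(f x) * A x α i j) ^ 2 ≤ _
  rw [mul_pow, Real.sq_sqrt (zero_le_one.trans hx)]
  refine mul_le_mul_of_nonneg_left ?_ (zero_le_one.trans hx)
  unfold normSq
  calc A x α i j ^ 2 ≤ ∑ j', A x α i j' ^ 2 :=
        Finset.single_le_sum (f := fun j' => A x α i j' ^ 2) (fun _ _ => sq_nonneg _)
          (Finset.mem_univ j)
    _ ≤ ∑ i', ∑ j', A x α i' j' ^ 2 :=
        Finset.single_le_sum (f := fun i' => ∑ j', A x α i' j' ^ 2)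
          (fun _ _ => by positivity) (Finset.mem_univ i)
    _ ≤ _ := Finset.single_le_sum (f := fun α' => ∑ i', ∑ j', A x α' i' j' ^ 2)
          (fun _ _ => by positivity) (Finset.mem_univ α)

theorem memLp_top_of_specialOrthogonal {Q : Plane → Matrix (Fin m) (Fin m) ℝ}
    (hm : ∀ i j, AEStronglyMeasurable (fun x => Q x i j) discMeasure)
    (hQ : ∀ᵐ x ∂discMeasure, Q x ∈ Matrix.specialOrthogonalGroup (Fin m) ℝ) (i j : Fin m) :
    MemLp (fun x => Q x i j) ∞ discMeasure := by
  refine memLp_top_of_bound (hm i j) 1 ?_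
  filter_upwards [hQ] with x hx using abs_entry_le_one hx i j

theorem IsW12SO.memLp_top {Q : Plane → Matrix (Fin m) (Fin m) ℝ}
    {dQ : Plane → Fin 2 → Matrix (Fin m) (Fin m) ℝ} (hQ : IsW12SO Q dQ) (i j : Fin m) :
    MemLp (fun x => Q x i j) ∞ discMeasure :=
  memLp_top_of_specialOrthogonal (fun i j => (hQ.1 i j).memLp.1) hQ.2 i j

theorem memLp_sqrt_mul_matrix {Q A : Plane → Matrix (Fin m) (Fin m) ℝ}
    (hQ : ∀ i j, MemLp (fun x => Q x i j) ∞ discMeasure)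
    (hA : ∀ i j, MemLp (fun x => √(f x) * A x i j) 2 discMeasure) (i j : Fin m) :
    MemLp (fun x => √(f x) * (Q x * A x) i j) 2 discMeasure := by
  have : (fun x => √(f x) * (Q x * A x) i j) =
      fun x => ∑ k, Q x i k * (√(f x) * A x k j) := by
    ext x
    rw [Matrix.mul_apply, Finset.mul_sum]
    exact Finset.sum_congr rfl fun k _ => by ring
  rw [this]
  exact memLp_finsetSum _ fun k _ => (hA k j).mul (hQ i k)

theorem memLp_sqrt_mul_gauge {Q : Plane → Matrix (Fin m) (Fin m) ℝ}
    {dQ Ω : Plane → Fin 2 → Matrix (Fin m) (Fin m) ℝ}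
    (hQ : ∀ i j, MemLp (fun x => Q x i j) ∞ discMeasure)
    (hΩ : ∀ α i j, MemLp (fun x => √(f x) * Ω x α i j) 2 discMeasure)
    (hdQ : ∀ α i j, MemLp (fun x => √(f x) * dQ x α i j) 2 discMeasure)
    (α : Fin 2) (i j : Fin m) :
    MemLp (fun x => √(f x) * (Q x * Ω x α - dQ x α) i j) 2 discMeasure := by
  have := (memLp_sqrt_mul_matrix (A := fun x => Ω x α) hQ (hΩ α) i j).sub (hdQ α i j)
  refine this.congr_norm ?_ (.of_forall fun x => ?_)
  · refine this.1.congr (.of_forall fun x => ?_)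
    simp [mul_sub]
  · simp [mul_sub]

theorem weightedEnergy_mul_orthogonal {R : Plane → Matrix (Fin m) (Fin m) ℝ}
    (hR : ∀ᵐ x ∂discMeasure, (R x).transpose * R x = 1)
    (A : Plane → Fin 2 → Matrix (Fin m) (Fin m) ℝ) :
    weightedEnergy f (fun x α => R x * A x α) = weightedEnergy f A := by
  refine lintegral_congr_ae ?_
  filter_upwards [hR] with x hx
  rw [normSq_mul_orthogonal hx]

theorem IsAdmissible.memLp_sqrt_mul (hf : AEStronglyMeasurable f discMeasure)
    (hf1 : ∀ᵐ x ∂discMeasure, 1 ≤ f x) {Q : Plane → Matrix (Fin m) (Fin m) ℝ}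
    {dQ : Plane → Fin 2 → Matrix (Fin m) (Fin m) ℝ} (h : IsAdmissible f Q dQ) (α : Fin 2)
    (i j : Fin m) : MemLp (fun x => √(f x) * dQ x α i j) 2 discMeasure :=
  memLp_of_weightedEnergy_lt_top hf hf1 (fun α i j => ((h.isW12SO.1 i j).memLp_grad α).1)
    h.energy_lt_top α i j

theorem isW12_of_sub_const {u : Plane → ℝ} {g : Fin 2 → Plane → ℝ} {c : ℝ}
    (h : IsW12 (fun x => u x - c) g) : IsW12 u g := by
  simpa using h.add (IsW12.const c)

theorem isAdmissible_one : IsAdmissible f (fun _ => (1 : Matrix (Fin m) (Fin m) ℝ))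
    (fun _ _ => 0) where
  isW12SO := ⟨fun i j => IsW12.const _, .of_forall fun _ => one_mem _⟩
  energy_lt_top := by simp [weightedEnergy, normSq]
  boundary i j := by simpa using isW12Zero_zero

theorem gaugeInf_le_weightedEnergy (Ω : Plane → Fin 2 → Matrix (Fin m) (Fin m) ℝ) :
    gaugeInf f Ω ≤ weightedEnergy f Ω := by
  refine (iInf_le_of_le (fun _ => 1) (iInf_le_of_le (fun _ _ => 0)
    (iInf_le_of_le isAdmissible_one ?_)))
  simp [gaugeEnergy]

/-- Finitely many sequences converging in `L²` have a common subsequence converging a.e. -/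
theorem exists_subseq_tendsto_ae {X : Type*} [MeasurableSpace X] {μ : Measure X} {ι : Type*}
    [Fintype ι] {u : ℕ → ι → X → ℝ} {w : ι → X → ℝ} (hu : ∀ k i, MemLp (u k i) 2 μ)
    (hw : ∀ i, MemLp (w i) 2 μ)
    (h : ∀ i, Tendsto (fun k => eLpNorm (fun x => u k i x - w i x) 2 μ) atTop (𝓝 0)) :
    ∃ τ : ℕ → ℕ, StrictMono τ ∧
      ∀ᵐ x ∂μ, ∀ i, Tendsto (fun k => u (τ k) i x) atTop (𝓝 (w i x)) := by
  have hm : ∀ k i, AEStronglyMeasurable (fun x => |u k i x - w i x|) μ :=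
    fun k i => ((hu k i).sub (hw i)).norm.1
  have h1 : Tendsto (fun k => eLpNorm (fun x => ∑ i, |u k i x - w i x|) 2 μ) atTop (𝓝 0) := by
    have h2 := tendsto_finsetSum Finset.univ fun i _ => h i
    rw [Finset.sum_const_zero] at h2
    refine tendsto_of_tendsto_of_tendsto_of_le_of_le tendsto_const_nhds h2 (fun _ => zero_le)
      fun k => ?_
    have h3 := eLpNorm_sum_le (p := 2) (μ := μ) (s := Finset.univ)
      (f := fun i x => |u k i x - w i x|) (fun i _ => hm k i) (by norm_num)
    refine (le_of_eq ?_).trans (h3.trans (le_of_eq ?_))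
    · congr 1; ext x; simp
    · exact Finset.sum_congr rfl fun i _ => eLpNorm_norm (fun x => u k i x - w i x)
  have h2 := tendstoInMeasure_of_tendsto_eLpNorm (p := 2) (g := fun _ => 0) (by norm_num)
    (fun k => Finset.aestronglyMeasurable_fun_sum _ fun i _ => hm k i)
    aestronglyMeasurable_const (by simpa [Pi.sub_def] using h1)
  obtain ⟨τ, hτ, hx⟩ := h2.exists_seq_tendsto_ae
  refine ⟨τ, hτ, ?_⟩
  filter_upwards [hx] with x hx i
  rw [tendsto_iff_norm_sub_tendsto_zero]
  refine squeeze_zero (fun _ => norm_nonneg _) (fun k => ?_) hx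
  exact Finset.single_le_sum (f := fun i => |u (τ k) i x - w i x|) (fun _ _ => abs_nonneg _)
    (Finset.mem_univ i)

end

/-! ### Existence of a minimiser -/

section

variable {m : ℕ} {f : Plane → ℝ}

theorem exists_minimizing_seq (Ω : Plane → Fin 2 → Matrix (Fin m) (Fin m) ℝ)
    (hI : gaugeInf f Ω ≠ ⊤) :
    ∃ (Q : ℕ → Plane → Matrix (Fin m) (Fin m) ℝ)
      (dQ : ℕ → Plane → Fin 2 → Matrix (Fin m) (Fin m) ℝ), ∀ k : ℕ, IsAdmissible f (Q k) (dQ k) ∧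
        gaugeEnergy f Ω (Q k) (dQ k) ≤
          ENNReal.ofReal ((gaugeInf f Ω).toReal + 1 / ((k : ℝ) + 1)) := by
  have h : ∀ k : ℕ, ∃ Q dQ, IsAdmissible f Q dQ ∧
      gaugeEnergy f Ω Q dQ ≤ ENNReal.ofReal ((gaugeInf f Ω).toReal + 1 / ((k : ℝ) + 1)) := by
    intro k
    have hk : (0 : ℝ) < 1 / ((k : ℝ) + 1) := by positivity
    have hlt : gaugeInf f Ω < ENNReal.ofReal ((gaugeInf f Ω).toReal + 1 / ((k : ℝ) + 1)) := by
      rw [ENNReal.ofReal_add ENNReal.toReal_nonneg hk.le, ENNReal.ofReal_toReal hI]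
      exact ENNReal.lt_add_right hI (by simpa using hk)
    conv_lhs at hlt => unfold gaugeInf
    simp only [iInf_lt_iff] at hlt
    obtain ⟨Q, dQ, hadm, hE⟩ := hlt
    exact ⟨Q, dQ, hadm, hE.le⟩
  choose Q dQ h using h
  exact ⟨Q, dQ, h⟩

/-- If the rotations `Q_k` converge a.e. to `q`, then `√f Q_k A` converges weakly to `√f q A`, by
dominated convergence. -/
theorem tendstoWeakly_sqrt_mul_matrix {Q : ℕ → Plane → Matrix (Fin m) (Fin m) ℝ}
    {q A : Plane → Matrix (Fin m) (Fin m) ℝ}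
    (hQm : ∀ k i j, MemLp (fun x => Q k x i j) ∞ discMeasure)
    (hQ : ∀ k, ∀ᵐ x ∂discMeasure, Q k x ∈ Matrix.specialOrthogonalGroup (Fin m) ℝ)
    (hA : ∀ i j, MemLp (fun x => √(f x) * A x i j) 2 discMeasure)
    (hlim : ∀ᵐ x ∂discMeasure, Tendsto (fun k => Q k x) atTop (𝓝 (q x))) (i j : Fin m) :
    TendstoWeakly discMeasure (fun k x => √(f x) * (Q k x * A x) i j)
      (fun x => √(f x) * (q x * A x) i j) := by
  intro v hv
  refine tendsto_integral_of_dominated_convergence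
    (fun x => ∑ l, |√(f x) * A x l j * v x|) (fun k => ?_) ?_ (fun k => ?_) ?_
  · exact (integrable_mul_of_memLp_two (memLp_sqrt_mul_matrix (hQm k) hA i j) hv).1
  · exact integrable_finsetSum _ fun l _ => (integrable_mul_of_memLp_two (hA l j) hv).norm
  · filter_upwards [hQ k] with x hx
    rw [Matrix.mul_apply, Finset.mul_sum, Finset.sum_mul]
    refine (norm_sum_le _ _).trans (Finset.sum_le_sum fun l _ => ?_)
    rw [Real.norm_eq_abs, show √(f x) * (Q k x i l * A x l j) * v x =
      Q k x i l * (√(f x) * A x l j * v x) by ring, abs_mul]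
    exact mul_le_of_le_one_left (abs_nonneg _) (abs_entry_le_one hx i l)
  · filter_upwards [hlim] with x hx
    have h1 : Tendsto (fun k => Q k x * A x) atTop (𝓝 (q x * A x)) := hx.mul_const (A x)
    have h2 : Tendsto (fun k => (Q k x * A x) i j) atTop (𝓝 ((q x * A x) i j)) :=
      ((continuous_id.matrix_elem i j).tendsto _).comp h1
    exact (h2.const_mul _).mul_const _

theorem one_le_sqrt_ae (hf1 : ∀ᵐ x ∂discMeasure, 1 ≤ f x) : ∀ᵐ x ∂discMeasure, 1 ≤ √(f x) := by
  filter_upwards [hf1] with x hx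
  simpa using Real.sqrt_le_sqrt hx

theorem memLp_div_sqrt (hf : AEStronglyMeasurable f discMeasure)
    (hf1 : ∀ᵐ x ∂discMeasure, 1 ≤ f x) {v : Plane → ℝ} (hv : MemLp v 2 discMeasure) :
    MemLp (fun x => v x / √(f x)) 2 discMeasure := by
  refine hv.mono (hv.1.div₀ (aestronglyMeasurable_sqrt hf)) ?_
  filter_upwards [one_le_sqrt_ae hf1] with x hx
  rw [norm_div, Real.norm_of_nonneg (zero_le_one.trans hx)]
  exact div_le_self (norm_nonneg _) hx

/-- The gauge energy controls the weighted gradient, since `|Q Ω| = |Ω|`. -/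
theorem IsAdmissible.integral_sqrt_mul_grad_sq_le (hf : AEStronglyMeasurable f discMeasure)
    (hf1 : ∀ᵐ x ∂discMeasure, 1 ≤ f x) {Ω : Plane → Fin 2 → Matrix (Fin m) (Fin m) ℝ}
    (hΩ : ∀ α i j, MemLp (fun x => √(f x) * Ω x α i j) 2 discMeasure)
    {Q : Plane → Matrix (Fin m) (Fin m) ℝ}
    {dQ : Plane → Fin 2 → Matrix (Fin m) (Fin m) ℝ} (h : IsAdmissible f Q dQ) {E : ℝ}
    (hE : ∑ p : Fin 2 × Fin m × Fin m,
      ∫ x, (√(f x) * (Q x * Ω x p.1 - dQ x p.1) p.2.1 p.2.2) ^ 2 ∂discMeasure ≤ E)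
    (α : Fin 2) (i j : Fin m) :
    ∫ x, (√(f x) * dQ x α i j) ^ 2 ∂discMeasure ≤
      2 * (∑ p : Fin 2 × Fin m × Fin m,
        ∫ x, (√(f x) * Ω x p.1 p.2.1 p.2.2) ^ 2 ∂discMeasure) + 2 * E := by
  have hQt := h.isW12SO.memLp_top
  have hQΩ := fun α => memLp_sqrt_mul_matrix (A := fun x => Ω x α) hQt (hΩ α)
  have hX := memLp_sqrt_mul_gauge hQt hΩ (h.memLp_sqrt_mul hf hf1)
  have e1 : ∑ p : Fin 2 × Fin m × Fin m,
      ∫ x, (√(f x) * (Q x * Ω x p.1) p.2.1 p.2.2) ^ 2 ∂discMeasure =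
      ∑ p : Fin 2 × Fin m × Fin m, ∫ x, (√(f x) * Ω x p.1 p.2.1 p.2.2) ^ 2 ∂discMeasure := by
    have h1 := weightedEnergy_mul_orthogonal (f := f) (R := Q)
      (h.isW12SO.2.mono fun x hx => transpose_mul_self_of_mem hx) Ω
    rw [weightedEnergy_eq hf1 hQΩ, weightedEnergy_eq hf1 hΩ] at h1
    rwa [ENNReal.ofReal_eq_ofReal_iff] at h1
    · exact Finset.sum_nonneg fun p _ => integral_nonneg fun x => sq_nonneg _
    · exact Finset.sum_nonneg fun p _ => integral_nonneg fun x => sq_nonneg _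
  have h2 := integral_sub_sq_le (hQΩ α i j) (hX α i j)
  have h3 : ∀ x, √(f x) * (Q x * Ω x α) i j - √(f x) * (Q x * Ω x α - dQ x α) i j =
      √(f x) * dQ x α i j := by
    intro x; rw [Matrix.sub_apply]; ring
  simp only [h3] at h2
  have h4 := Finset.single_le_sum (f := fun p : Fin 2 × Fin m × Fin m =>
    ∫ x, (√(f x) * (Q x * Ω x p.1) p.2.1 p.2.2) ^ 2 ∂discMeasure)
    (fun p _ => integral_nonneg fun x => sq_nonneg _) (Finset.mem_univ (α, i, j))
  have h5 := Finset.single_le_sum (f := fun p : Fin 2 × Fin m × Fin m =>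
    ∫ x, (√(f x) * (Q x * Ω x p.1 - dQ x p.1) p.2.1 p.2.2) ^ 2 ∂discMeasure)
    (fun p _ => integral_nonneg fun x => sq_nonneg _) (Finset.mem_univ (α, i, j))
  rw [e1] at h4
  simp only at h4 h5
  linarith

theorem integral_sq_le_sqrt_mul (hf1 : ∀ᵐ x ∂discMeasure, 1 ≤ f x) {v : Plane → ℝ}
    (hv : MemLp (fun x => √(f x) * v x) 2 discMeasure) :
    ∫ x, v x ^ 2 ∂discMeasure ≤ ∫ x, (√(f x) * v x) ^ 2 ∂discMeasure := by
  refine integral_mono_of_nonneg (.of_forall fun x => sq_nonneg _) hv.integrable_sq ?_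
  filter_upwards [hf1] with x hx
  simp only [mul_pow, Real.sq_sqrt (zero_le_one.trans hx)]
  nlinarith [sq_nonneg (v x)]

/-- Existence of a minimiser by the direct method. The weak gradient of the limit is obtained from
the weak `L²` limit of `√f ∇Q_k`, so that its weighted energy is finite by construction. -/
theorem exists_minimizer (hf : AEStronglyMeasurable f discMeasure)
    (hf1 : ∀ᵐ x ∂discMeasure, 1 ≤ f x) {Ω : Plane → Fin 2 → Matrix (Fin m) (Fin m) ℝ}
    (hΩ : ∀ α i j, MemLp (fun x => √(f x) * Ω x α i j) 2 discMeasure) :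
    ∃ (Q : Plane → Matrix (Fin m) (Fin m) ℝ) (dQ : Plane → Fin 2 → Matrix (Fin m) (Fin m) ℝ),
      IsAdmissible f Q dQ ∧ gaugeEnergy f Ω Q dQ = gaugeInf f Ω := by
  classical
  have hI : gaugeInf f Ω ≠ ⊤ := by
    refine ne_top_of_le_ne_top ?_ (gaugeInf_le_weightedEnergy Ω)
    rw [weightedEnergy_eq hf1 hΩ]
    exact ENNReal.ofReal_ne_top
  obtain ⟨Q, dQ, hQE⟩ := exists_minimizing_seq Ω hI
  have hadm := fun k => (hQE k).1
  set e := (gaugeInf f Ω).toReal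
  have hQt := fun k => (hadm k).isW12SO.memLp_top
  have hGL := fun k => (hadm k).memLp_sqrt_mul hf hf1
  have hXL := fun k => memLp_sqrt_mul_gauge (hQt k) hΩ (hGL k)
  have hXE : ∀ k, ∑ p : Fin 2 × Fin m × Fin m,
      ∫ x, (√(f x) * (Q k x * Ω x p.1 - dQ k x p.1) p.2.1 p.2.2) ^ 2 ∂discMeasure ≤
        e + 1 / ((k : ℝ) + 1) := by
    intro k
    have h1 := (hQE k).2
    rw [gaugeEnergy, weightedEnergy_eq hf1 (hXL k)] at h1
    exact (ENNReal.ofReal_le_ofReal_iff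
      (add_nonneg ENNReal.toReal_nonneg (by positivity))).1 h1
  have hXE' : ∀ k, ∑ p : Fin 2 × Fin m × Fin m,
      ∫ x, (√(f x) * (Q k x * Ω x p.1 - dQ k x p.1) p.2.1 p.2.2) ^ 2 ∂discMeasure ≤ e + 1 := by
    intro k
    have : 1 / ((k : ℝ) + 1) ≤ 1 := by
      rw [div_le_one (by positivity)]; linarith [k.cast_nonneg (α := ℝ)]
    linarith [hXE k]
  obtain ⟨C, hC⟩ : ∃ C, ∀ k α i j, ∫ x, (√(f x) * dQ k x α i j) ^ 2 ∂discMeasure ≤ C :=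
    ⟨_, fun k => (hadm k).integral_sqrt_mul_grad_sq_le hf hf1 hΩ (hXE' k)⟩
  -- the sequences `Q_k - 1` and `√f ∇Q_k`, all bounded in `L²`
  let U : ℕ → Option (Fin 2) × Fin m × Fin m → Plane → ℝ := fun k p x =>
    p.1.elim (Q k x p.2.1 p.2.2 - (1 : Matrix (Fin m) (Fin m) ℝ) p.2.1 p.2.2)
      (fun α => √(f x) * dQ k x α p.2.1 p.2.2)
  have hUL : ∀ k p, MemLp (U k p) 2 discMeasure := by
    rintro k ⟨_ | α, i, j⟩
    · exact ((hadm k).boundary i j).1.memLp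
    · exact hGL k α i j
  set D := max C (∫ _x, (2 : ℝ) ^ 2 ∂discMeasure)
  have hUD : ∀ k p, ∫ x, U k p x ^ 2 ∂discMeasure ≤ D := by
    rintro k ⟨_ | α, i, j⟩
    · refine le_trans (integral_mono_ae (hUL k (none, i, j)).integrable_sq
        (integrable_const _) ?_) (le_max_right _ _)
      filter_upwards [(hadm k).isW12SO.2] with x hx
      refine sq_le_sq' ?_ ?_
      -- entries of orthogonal matrices lie in `[-1, 1]`
      all_goals
        have h1 := abs_le.1 (abs_entry_le_one hx i j)
        have h2 := abs_le.1 (abs_entry_le_one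
          (one_mem (Matrix.specialOrthogonalGroup (Fin m) ℝ)) i j)
        simp only [U, Option.elim]
        linarith [h1.1, h1.2, h2.1, h2.2]
    · exact (hC k α i j).trans (le_max_left _ _)
  obtain ⟨σ, hσ, w, hw⟩ := exists_subseq_tendstoWeakly U hUL D hUD
  let q : Plane → Matrix (Fin m) (Fin m) ℝ := fun x =>
    Matrix.of fun i j => w (none, i, j) x + (1 : Matrix (Fin m) (Fin m) ℝ) i j
  let dq : Plane → Fin 2 → Matrix (Fin m) (Fin m) ℝ := fun x α =>
    Matrix.of fun i j => w (some α, i, j) x / √(f x)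
  have hfdq : ∀ α i j, (fun x => √(f x) * dq x α i j) =ᵐ[discMeasure] w (some α, i, j) := by
    intro α i j
    filter_upwards [one_le_sqrt_ae hf1] with x hx
    have : √(f x) ≠ 0 := (zero_lt_one.trans_le hx).ne'
    simp only [dq, Matrix.of_apply]
    field_simp
  have hfdqL : ∀ α i j, MemLp (fun x => √(f x) * dq x α i j) 2 discMeasure := fun α i j =>
    (memLp_congr_ae (hfdq α i j)).2 (hw _).1
  have hdqL : ∀ α i j, MemLp (fun x => dq x α i j) 2 discMeasure := fun α i j =>
    memLp_div_sqrt hf hf1 (hw _).1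
  have hdQw : ∀ α i j, TendstoWeakly discMeasure (fun k x => dQ (σ k) x α i j)
      (fun x => dq x α i j) := by
    intro α i j v hv
    have h1 := (hw (some α, i, j)).2 _ (memLp_div_sqrt hf hf1 hv)
    have h2 : ∀ b : Plane → ℝ, ∫ x, √(f x) * b x * (v x / √(f x)) ∂discMeasure =
        ∫ x, b x * v x ∂discMeasure := by
      intro b
      refine integral_congr_ae ?_
      filter_upwards [one_le_sqrt_ae hf1] with x hx
      have : √(f x) ≠ 0 := (zero_lt_one.trans_le hx).ne'
      field_simp
    have h3 : ∫ x, w (some α, i, j) x * (v x / √(f x)) ∂discMeasure =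
        ∫ x, dq x α i j * v x ∂discMeasure :=
      integral_congr_ae (.of_forall fun x => by simp only [dq, Matrix.of_apply]; ring)
    rw [h3] at h1
    exact h1.congr fun k => h2 fun x => dQ (σ k) x α i j
  have hzero : ∀ i j, IsW12Zero (w (none, i, j)) (fun α x => dq x α i j) := fun i j =>
    IsW12Zero.of_tendstoWeakly (fun k => (hadm (σ k)).boundary i j) (hw _).1
      (fun α => hdqL α i j) (hw (none, i, j)).2 (fun α => hdQw α i j)
  -- strong convergence keeps the constraint `Q ∈ SO(m)`
  have hstrong : ∀ i j, Tendsto (fun k => eLpNorm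
      (fun x => U (σ k) (none, i, j) x - w (none, i, j) x) 2 discMeasure) atTop (𝓝 0) :=
    fun i j => rellich (C := D) (fun k => (hadm (σ k)).boundary i j) (hw _).1
      (hw (none, i, j)).2 (fun k => hUD _ (none, i, j))
      fun k α => (integral_sq_le_sqrt_mul hf1 (hGL _ α i j)).trans (hUD _ (some α, i, j))
  obtain ⟨τ, hτ, hae⟩ := exists_subseq_tendsto_ae (ι := Fin m × Fin m)
    (u := fun k p => U (σ k) (none, p.1, p.2)) (w := fun p => w (none, p.1, p.2))
    (fun k p => hUL _ _) (fun p => (hw _).1) (fun p => hstrong p.1 p.2)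
  have hlim : ∀ᵐ x ∂discMeasure, Tendsto (fun k => Q (σ (τ k)) x) atTop (𝓝 (q x)) := by
    filter_upwards [hae] with x hx
    refine tendsto_pi_nhds.2 fun i => tendsto_pi_nhds.2 fun j => ?_
    have := (hx (i, j)).add_const ((1 : Matrix (Fin m) (Fin m) ℝ) i j)
    simpa [U, q] using this
  have hSO : ∀ᵐ x ∂discMeasure, q x ∈ Matrix.specialOrthogonalGroup (Fin m) ℝ := by
    filter_upwards [hlim, ae_all_iff.2 fun k => (hadm (σ (τ k))).isW12SO.2] with x hx hk
    exact isClosed_specialOrthogonalGroup.mem_of_tendsto hx (.of_forall hk)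
  have hbd : EqIdOnBoundary q dq := fun i j => by simpa [q] using hzero i j
  have hqadm : IsAdmissible f q dq := by
    refine ⟨⟨fun i j => isW12_of_sub_const (hbd i j).1, hSO⟩, ?_, hbd⟩
    rw [weightedEnergy_eq hf1 hfdqL]
    exact ENNReal.ofReal_lt_top
  refine ⟨q, dq, hqadm, le_antisymm ?_ ?_⟩
  · have hqX := memLp_sqrt_mul_gauge hqadm.isW12SO.memLp_top hΩ hfdqL
    rw [gaugeEnergy, weightedEnergy_eq hf1 hqX, ← ENNReal.ofReal_toReal hI]
    refine ENNReal.ofReal_le_ofReal ?_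
    refine TendstoWeakly.sum_integral_sq_le
      (u := fun k (p : Fin 2 × Fin m × Fin m) x =>
        √(f x) * (Q (σ (τ k)) x * Ω x p.1 - dQ (σ (τ k)) x p.1) p.2.1 p.2.2)
      (E := fun k => e + 1 / ((σ (τ k) : ℕ) + 1 : ℝ))
      (fun k p => hXL _ _ _ _) (fun p => hqX _ _ _) ?_ (fun k => hXE _) ?_
    · rintro ⟨α, i, j⟩ v hv
      have h1 := tendstoWeakly_sqrt_mul_matrix (fun k => hQt (σ (τ k)))
        (fun k => (hadm (σ (τ k))).isW12SO.2) (hΩ α) hlim i j v hv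
      have h2 := ((hw (some α, i, j)).2.comp hτ) v hv
      have h3 := h1.sub h2
      have h4 : ∫ x, w (some α, i, j) x * v x ∂discMeasure =
          ∫ x, √(f x) * dq x α i j * v x ∂discMeasure := by
        refine integral_congr_ae ?_
        filter_upwards [hfdq α i j] with x hx
        rw [← hx]
      rw [h4, ← integral_sub (integrable_mul_of_memLp_two
        (memLp_sqrt_mul_matrix hqadm.isW12SO.memLp_top (hΩ α) i j) hv)
        (integrable_mul_of_memLp_two (hfdqL α i j) hv)] at h3
      have h5 : ∀ (A B : Matrix (Fin m) (Fin m) ℝ) (a b : ℝ),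
          a * (A - B) i j * b = a * A i j * b - a * B i j * b := by
        intro A B a b; rw [Matrix.sub_apply]; ring
      simp only [h5]
      refine h3.congr fun k => ?_
      rw [integral_sub (integrable_mul_of_memLp_two
        (memLp_sqrt_mul_matrix (hQt (σ (τ k))) (hΩ α) i j) hv)
        (integrable_mul_of_memLp_two (hGL _ α i j) hv)]
      rfl
    · have := (tendsto_one_div_add_atTop_nhds_zero_nat (𝕜 := ℝ)).comp (hσ.comp hτ).tendsto_atTop
      simpa using this.const_add e
  · exact iInf_le_of_le q (iInf_le_of_le dq (iInf_le_of_le hqadm le_rfl))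

end

/-! ### Rotations and the first variation -/

section

variable {m : ℕ} {f : Plane → ℝ}

/-- The generator `E_ij - E_ji` of the rotations of the coordinate plane `(i, j)`. -/
def skewUnit (i j : Fin m) : Matrix (Fin m) (Fin m) ℝ := Matrix.single i j 1 - Matrix.single j i 1

theorem skewUnit_cube (i j : Fin m) :
    skewUnit i j * (skewUnit i j * skewUnit i j) = -skewUnit i j := by
  unfold skewUnit
  by_cases h : i = j
  · subst h; simp
  · have h' : j ≠ i := Ne.symm h
    simp [sub_mul, mul_sub, Matrix.single_mul_single_same, Matrix.single_mul_single_of_ne, h, h']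
    abel

theorem transpose_skewUnit (i j : Fin m) : (skewUnit i j).transpose = -skewUnit i j := by
  simp [skewUnit]

/-- The rotation `exp (θ A)`, written by Rodrigues' formula, which is valid for `A` skew with
`A³ = -A`. -/
noncomputable def rot (A : Matrix (Fin m) (Fin m) ℝ) (θ : ℝ) : Matrix (Fin m) (Fin m) ℝ :=
  1 + (Real.sin θ • A + (1 - Real.cos θ) • (A * A))

/-- The products of polynomials of degree two in `A`, reduced by `A³ = -A`. -/
theorem rodrigues_mul {A : Matrix (Fin m) (Fin m) ℝ} (hA : A * (A * A) = -A) (a b c d : ℝ) :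
    (1 + (a • A + b • (A * A))) * (1 + (c • A + d • (A * A))) =
      1 + ((a + c - a * d - b * c) • A + (b + d + a * c - b * d) • (A * A)) := by
  have h1 : A * A * A = -A := by rw [Matrix.mul_assoc, hA]
  have h2 : A * A * (A * A) = -(A * A) := by rw [Matrix.mul_assoc, hA, Matrix.mul_neg]
  simp only [add_mul, mul_add, Matrix.one_mul, Matrix.mul_one, Matrix.smul_mul, Matrix.mul_smul,
    hA, h1, h2]
  module

theorem rot_transpose_mul {A : Matrix (Fin m) (Fin m) ℝ} (hA : A * (A * A) = -A)
    (hA' : A.transpose = -A) (θ : ℝ) : (rot A θ).transpose * rot A θ = 1 := by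
  have e : (rot A θ).transpose = 1 + ((-Real.sin θ) • A + (1 - Real.cos θ) • (A * A)) := by
    simp [rot, Matrix.transpose_add, Matrix.transpose_mul, hA']
  rw [e, rot, rodrigues_mul hA]
  have h1 : -Real.sin θ + Real.sin θ - -Real.sin θ * (1 - Real.cos θ) -
      (1 - Real.cos θ) * Real.sin θ = 0 := by ring
  have h2 : 1 - Real.cos θ + (1 - Real.cos θ) + -Real.sin θ * Real.sin θ -
      (1 - Real.cos θ) * (1 - Real.cos θ) = 0 := by
    linarith [Real.sin_sq_add_cos_sq θ, sq (Real.sin θ), sq (Real.cos θ)]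
  rw [h1, h2]
  simp

theorem rot_eq_sq {A : Matrix (Fin m) (Fin m) ℝ} (hA : A * (A * A) = -A) (θ : ℝ) :
    rot A (2 * θ) = rot A θ * rot A θ := by
  rw [rot, rot, rodrigues_mul hA, Real.sin_two_mul, Real.cos_two_mul]
  congr 3
  · ring
  · nlinarith [Real.sin_sq_add_cos_sq θ]

/-- The determinant is `1` because `rot A θ` is the square of `rot A (θ / 2)`. -/
theorem rot_mem {A : Matrix (Fin m) (Fin m) ℝ} (hA : A * (A * A) = -A)
    (hA' : A.transpose = -A) (θ : ℝ) :
    rot A θ ∈ Matrix.specialOrthogonalGroup (Fin m) ℝ := by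
  refine Matrix.mem_specialOrthogonalGroup_iff.2
    ⟨(Matrix.mem_orthogonalGroup_iff' _ _).2 (rot_transpose_mul hA hA' θ), ?_⟩
  have h := congrArg Matrix.det (rot_transpose_mul hA hA' (θ / 2))
  rw [Matrix.det_mul, Matrix.det_transpose, Matrix.det_one] at h
  rw [show θ = 2 * (θ / 2) by ring, rot_eq_sq hA, Matrix.det_mul, h]

theorem rot_comm (A : Matrix (Fin m) (Fin m) ℝ) (θ : ℝ) : A * rot A θ = rot A θ * A := by
  simp only [rot, mul_add, add_mul, Matrix.mul_one, Matrix.one_mul, Matrix.mul_smul,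
    Matrix.smul_mul, Matrix.mul_assoc]

theorem mul_rot {A : Matrix (Fin m) (Fin m) ℝ} (hA : A * (A * A) = -A) (θ : ℝ) :
    A * rot A θ = Real.cos θ • A + Real.sin θ • (A * A) := by
  simp only [rot, mul_add, Matrix.mul_one, Matrix.mul_smul, hA]
  module

/-- Composition of a test function with a smooth function vanishing at `0`. -/
noncomputable def compTest (γ : ℝ → ℝ) (hγ : ContDiff ℝ ∞ γ) (h0 : γ 0 = 0)
    (φ : 𝓓(disc, ℝ)) : 𝓓(disc, ℝ) where
  toFun x := γ (φ x)
  contDiff' := hγ.comp φ.contDiff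
  hasCompactSupport' := φ.hasCompactSupport.comp_left h0
  tsupport_subset' := (tsupport_comp_subset h0 _).trans φ.tsupport_subset

theorem partialDeriv_comp {γ : ℝ → ℝ} {γ' : ℝ} {φ : 𝓓(disc, ℝ)} {x : Plane}
    (h : HasDerivAt γ γ' (φ x)) (α : Fin 2) :
    partialDeriv α (fun y => γ (φ y)) x = γ' * partialDeriv α φ x := by
  unfold partialDeriv
  have := (h.comp_hasFDerivAt x (differentiable_test φ x).hasFDerivAt).fderiv
  simp only [Function.comp_def] at this
  rw [this]
  simp

/-- The entries of `rot A (t φ) - 1`, as test functions. -/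
noncomputable def rotTest (A : Matrix (Fin m) (Fin m) ℝ) (t : ℝ) (φ : 𝓓(disc, ℝ)) (i j : Fin m) :
    𝓓(disc, ℝ) :=
  compTest (fun s => Real.sin (t * s) * A i j + (1 - Real.cos (t * s)) * (A * A) i j)
    (by fun_prop) (by simp) φ

theorem rotTest_apply (A : Matrix (Fin m) (Fin m) ℝ) (t : ℝ) (φ : 𝓓(disc, ℝ)) (i j : Fin m)
    (x : Plane) : rotTest A t φ i j x = (rot A (t * φ x) - 1) i j := by
  simp [rot, rotTest, compTest]

theorem partialDeriv_rotTest {A : Matrix (Fin m) (Fin m) ℝ} (hA : A * (A * A) = -A) (t : ℝ)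
    (φ : 𝓓(disc, ℝ)) (i j : Fin m) (α : Fin 2) (x : Plane) :
    partialDeriv α (rotTest A t φ i j) x =
      ((t * partialDeriv α φ x) • (A * rot A (t * φ x))) i j := by
  have h1 : HasDerivAt (fun s => t * s) t (φ x) := by
    simpa using (hasDerivAt_id (φ x)).const_mul t
  have h := (h1.sin.mul_const (A i j)).add ((h1.cos.const_sub 1).mul_const ((A * A) i j))
  have h2 := partialDeriv_comp h α
  refine h2.trans ?_
  rw [mul_rot hA]
  simp only [Matrix.smul_apply, Matrix.add_apply, smul_eq_mul]
  ring

theorem memLp_top_matrix_mul {P Q : Plane → Matrix (Fin m) (Fin m) ℝ}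
    (hP : ∀ i j, MemLp (fun x => P x i j) ∞ discMeasure)
    (hQ : ∀ i j, MemLp (fun x => Q x i j) ∞ discMeasure) (i j : Fin m) :
    MemLp (fun x => (P x * Q x) i j) ∞ discMeasure := by
  simp only [Matrix.mul_apply]
  exact memLp_finsetSum _ fun k _ => (hQ k j).mul (hP i k)

theorem memLp_sqrt (hf : Integrable f discMeasure) (hf1 : ∀ᵐ x ∂discMeasure, 1 ≤ f x) :
    MemLp (fun x => √(f x)) 2 discMeasure := by
  refine (memLp_two_iff_integrable_sq (aestronglyMeasurable_sqrt hf.1)).2 (hf.congr ?_)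
  filter_upwards [hf1] with x hx
  rw [Real.sq_sqrt (zero_le_one.trans hx)]

theorem memLp_sqrt_mul_partialDeriv (hf : Integrable f discMeasure)
    (hf1 : ∀ᵐ x ∂discMeasure, 1 ≤ f x) {b : Plane → ℝ} (hb : MemLp b ∞ discMeasure)
    (φ : 𝓓(disc, ℝ)) (α : Fin 2) :
    MemLp (fun x => √(f x) * (partialDeriv α φ x * b x)) 2 discMeasure := by
  have h1 : MemLp (fun x => partialDeriv α φ x * b x) ∞ discMeasure :=
    hb.mul (memLp_partialDeriv φ α ∞)
  exact h1.mul (memLp_sqrt hf hf1)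

theorem memLp_top_rot {A : Matrix (Fin m) (Fin m) ℝ} (hA : A * (A * A) = -A)
    (hA' : A.transpose = -A) (t : ℝ) (φ : 𝓓(disc, ℝ)) (i j : Fin m) :
    MemLp (fun x => rot A (t * φ x) i j) ∞ discMeasure := by
  refine memLp_top_of_specialOrthogonal (fun i j => ?_) (.of_forall fun x => rot_mem hA hA' _) i j
  have : (fun x => rot A (t * φ x) i j) =
      fun x => rotTest A t φ i j x + (1 : Matrix (Fin m) (Fin m) ℝ) i j := by
    ext x; simp [rotTest_apply]
  rw [this]
  exact ((rotTest A t φ i j).continuous.add continuous_const).aestronglyMeasurable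

/-- Rotating a competitor `Q` on the left by `exp (t φ A)` gives a competitor. With
`N = exp (t φ A) - 1`, whose entries are test functions, the boundary condition follows from
`(1 + N) Q - 1 = (Q - 1) + N (Q - 1) + N`. -/
theorem IsAdmissible.rotate (hf : Integrable f discMeasure)
    (hf1 : ∀ᵐ x ∂discMeasure, 1 ≤ f x) {Q : Plane → Matrix (Fin m) (Fin m) ℝ}
    {dQ : Plane → Fin 2 → Matrix (Fin m) (Fin m) ℝ} (h : IsAdmissible f Q dQ)
    {A : Matrix (Fin m) (Fin m) ℝ} (hA : A * (A * A) = -A) (hA' : A.transpose = -A) (t : ℝ)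
    (φ : 𝓓(disc, ℝ)) :
    IsAdmissible f (fun x => rot A (t * φ x) * Q x)
      (fun x α => rot A (t * φ x) * dQ x α +
        (t * partialDeriv α φ x) • (A * rot A (t * φ x) * Q x)) := by
  have hbd : EqIdOnBoundary (fun x => rot A (t * φ x) * Q x)
      (fun x α => rot A (t * φ x) * dQ x α +
        (t * partialDeriv α φ x) • (A * rot A (t * φ x) * Q x)) := by
    intro i j
    have h1 := (h.boundary i j).add
      ((IsW12Zero.sum Finset.univ fun k => (h.boundary k j).mul_test (rotTest A t φ i k)).add
        (isW12Zero_test (rotTest A t φ i j)))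
    simp only [partialDeriv_rotTest hA, rotTest_apply] at h1
    convert h1 using 1
    · ext x
      have e : rot A (t * φ x) * Q x - 1 =
          (Q x - 1) + ((rot A (t * φ x) - 1) * (Q x - 1) + (rot A (t * φ x) - 1)) := by
        noncomm_ring
      have e2 := congrFun (congrFun e i) j
      rw [Matrix.sub_apply, Matrix.add_apply, Matrix.add_apply, Matrix.mul_apply] at e2
      exact e2
    · ext α x
      set N := (t * partialDeriv α φ x) • (A * rot A (t * φ x)) with hN
      have e : rot A (t * φ x) * dQ x α +
          (t * partialDeriv α φ x) • (A * rot A (t * φ x) * Q x) =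
          dQ x α + (((rot A (t * φ x) - 1) * dQ x α + N * (Q x - 1)) + N) := by
        rw [← Matrix.smul_mul, ← hN]
        noncomm_ring
      have e2 := congrFun (congrFun e i) j
      refine e2.trans ?_
      simp only [Matrix.add_apply, Matrix.mul_apply, Finset.sum_add_distrib]
      rfl
  have hQt := h.isW12SO.memLp_top
  have hrot := memLp_top_rot hA hA' t φ
  refine ⟨⟨fun i j => isW12_of_sub_const (hbd i j).1, ?_⟩, ?_, hbd⟩
  · filter_upwards [h.isW12SO.2] with x hx using mul_mem (rot_mem hA hA' _) hx
  · rw [weightedEnergy_eq hf1]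
    · exact ENNReal.ofReal_lt_top
    · intro α i j
      have h1 := memLp_sqrt_mul_matrix (A := fun x => dQ x α) hrot
        (h.memLp_sqrt_mul hf.1 hf1 α) i j
      have h2 := memLp_sqrt_mul_partialDeriv hf hf1 (memLp_top_matrix_mul
        (memLp_top_matrix_mul (P := fun _ => A) (fun i j => memLp_const _) hrot) hQt i j) φ α
      refine (h1.add (h2.const_mul t)).ae_eq (.of_forall fun x => ?_)
      simp only [Pi.add_apply, Matrix.add_apply, Matrix.smul_apply, smul_eq_mul]
      ring

/-- Since `A` commutes with `exp (t φ A)`, the rotation factors out of the gauge field and the energy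
of the rotated competitor is a quadratic polynomial in `t`. -/
theorem gaugeEnergy_rotate {A : Matrix (Fin m) (Fin m) ℝ} (hA : A * (A * A) = -A)
    (hA' : A.transpose = -A) (t : ℝ) (φ : 𝓓(disc, ℝ))
    (Ω : Plane → Fin 2 → Matrix (Fin m) (Fin m) ℝ) (Q : Plane → Matrix (Fin m) (Fin m) ℝ)
    (dQ : Plane → Fin 2 → Matrix (Fin m) (Fin m) ℝ) :
    gaugeEnergy f Ω (fun x => rot A (t * φ x) * Q x)
      (fun x α => rot A (t * φ x) * dQ x α +
        (t * partialDeriv α φ x) • (A * rot A (t * φ x) * Q x)) =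
    weightedEnergy f (fun x α => (Q x * Ω x α - dQ x α) -
      t • (partialDeriv α φ x • (A * Q x))) := by
  rw [gaugeEnergy, ← weightedEnergy_mul_orthogonal (R := fun x => rot A (t * φ x))
    (.of_forall fun x => rot_transpose_mul hA hA' _)
    (fun x α => (Q x * Ω x α - dQ x α) - t • (partialDeriv α φ x • (A * Q x)))]
  congr 1
  ext1 x
  ext1 α
  rw [rot_comm, mul_sub, mul_sub, smul_smul, Matrix.mul_smul, Matrix.mul_assoc, Matrix.mul_assoc,
    sub_sub]

theorem eq_zero_of_forall_quadratic {a b c : ℝ} (hc : 0 ≤ c)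
    (h : ∀ t : ℝ, a ≤ a - 2 * t * b + t ^ 2 * c) : b = 0 := by
  -- close to the minimiser `b / c` of the right-hand side, with `c + 1` as `c` may vanish
  have h1 := h (b / (c + 1))
  have h2 : 0 < c + 1 := by linarith
  have h3 : a - 2 * (b / (c + 1)) * b + (b / (c + 1)) ^ 2 * c =
      a - b ^ 2 * (c + 2) / (c + 1) ^ 2 := by field_simp; ring
  rw [h3] at h1
  have h4 : b ^ 2 * (c + 2) / (c + 1) ^ 2 ≤ 0 := by linarith
  have h5 : b ^ 2 * (c + 2) ≤ 0 := by
    by_contra hcon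
    push Not at hcon
    exact absurd h4 (not_le.2 (by positivity))
  have h6 : b ^ 2 ≤ 0 := by nlinarith [sq_nonneg b]
  exact pow_eq_zero_iff (two_ne_zero) |>.1 (le_antisymm h6 (sq_nonneg b))

/-- The first variation of the gauge energy vanishes at a minimiser. -/
theorem first_variation (hf : Integrable f discMeasure)
    (hf1 : ∀ᵐ x ∂discMeasure, 1 ≤ f x) {Ω : Plane → Fin 2 → Matrix (Fin m) (Fin m) ℝ}
    (hΩ : ∀ α i j, MemLp (fun x => √(f x) * Ω x α i j) 2 discMeasure)
    {Q : Plane → Matrix (Fin m) (Fin m) ℝ}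
    {dQ : Plane → Fin 2 → Matrix (Fin m) (Fin m) ℝ} (h : IsAdmissible f Q dQ)
    (hmin : gaugeEnergy f Ω Q dQ = gaugeInf f Ω)
    {A : Matrix (Fin m) (Fin m) ℝ} (hA : A * (A * A) = -A) (hA' : A.transpose = -A)
    (φ : 𝓓(disc, ℝ)) :
    ∑ p : Fin 2 × Fin m × Fin m, ∫ x, (√(f x) * (Q x * Ω x p.1 - dQ x p.1) p.2.1 p.2.2) *
      (√(f x) * (partialDeriv p.1 φ x * (A * Q x) p.2.1 p.2.2)) ∂discMeasure = 0 := by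
  have hX := memLp_sqrt_mul_gauge h.isW12SO.memLp_top hΩ (h.memLp_sqrt_mul hf.1 hf1)
  have hY : ∀ α i j, MemLp (fun x => √(f x) * (partialDeriv α φ x * (A * Q x) i j)) 2
      discMeasure := fun α i j => memLp_sqrt_mul_partialDeriv hf hf1
        (memLp_top_matrix_mul (P := fun _ => A) (fun i j => memLp_const _)
          h.isW12SO.memLp_top i j) φ α
  have e : ∀ (t : ℝ) (x : Plane) (α : Fin 2) (i j : Fin m),
      √(f x) * ((Q x * Ω x α - dQ x α) - t • (partialDeriv α φ x • (A * Q x))) i j =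
      √(f x) * (Q x * Ω x α - dQ x α) i j -
        t * (√(f x) * (partialDeriv α φ x * (A * Q x) i j)) := by
    intro t x α i j
    rw [Matrix.sub_apply (Q x * Ω x α - dQ x α), Matrix.smul_apply, Matrix.smul_apply]
    simp only [smul_eq_mul]
    ring
  refine eq_zero_of_forall_quadratic
    (a := ∑ p : Fin 2 × Fin m × Fin m,
      ∫ x, (√(f x) * (Q x * Ω x p.1 - dQ x p.1) p.2.1 p.2.2) ^ 2 ∂discMeasure)
    (c := ∑ p : Fin 2 × Fin m × Fin m,
      ∫ x, (√(f x) * (partialDeriv p.1 φ x * (A * Q x) p.2.1 p.2.2)) ^ 2 ∂discMeasure)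
    (Finset.sum_nonneg fun p _ => integral_nonneg fun x => sq_nonneg _) fun t => ?_
  have hXt : ∀ α i j, MemLp (fun x => √(f x) *
      ((Q x * Ω x α - dQ x α) - t • (partialDeriv α φ x • (A * Q x))) i j) 2 discMeasure := by
    intro α i j
    simp only [e]
    exact (hX α i j).sub ((hY α i j).const_mul t)
  have hle : gaugeEnergy f Ω Q dQ ≤ gaugeEnergy f Ω (fun x => rot A (t * φ x) * Q x)
      (fun x α => rot A (t * φ x) * dQ x α +
        (t * partialDeriv α φ x) • (A * rot A (t * φ x) * Q x)) := by
    rw [hmin]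
    exact iInf_le_of_le _ (iInf_le_of_le _ (iInf_le_of_le (h.rotate hf hf1 hA hA' t φ) le_rfl))
  rw [gaugeEnergy_rotate hA hA', gaugeEnergy, weightedEnergy_eq hf1 hX, weightedEnergy_eq hf1 hXt,
    ENNReal.ofReal_le_ofReal_iff
      (Finset.sum_nonneg fun p _ => integral_nonneg fun x => sq_nonneg _)] at hle
  refine hle.trans (le_of_eq ?_)
  rw [Finset.mul_sum, Finset.mul_sum, ← Finset.sum_sub_distrib, ← Finset.sum_add_distrib]
  refine Finset.sum_congr rfl fun p _ => ?_
  have i1 := (hX p.1 p.2.1 p.2.2).integrable_sq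
  have i2 := (integrable_mul_of_memLp_two (hX p.1 p.2.1 p.2.2)
    (hY p.1 p.2.1 p.2.2)).const_mul (2 * t)
  have i3 := (hY p.1 p.2.1 p.2.2).integrable_sq.const_mul (t ^ 2)
  have i4 : Integrable (fun x => (√(f x) * (Q x * Ω x p.1 - dQ x p.1) p.2.1 p.2.2) ^ 2 -
      2 * t * ((√(f x) * (Q x * Ω x p.1 - dQ x p.1) p.2.1 p.2.2) *
        (√(f x) * (partialDeriv p.1 φ x * (A * Q x) p.2.1 p.2.2)))) discMeasure := i1.sub i2
  rw [← integral_const_mul, ← integral_const_mul, ← integral_sub i1 i2, ← integral_add i4 i3]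
  refine integral_congr_ae (.of_forall fun x => ?_)
  simp only [e]
  ring

end

/-! ### The Euler-Lagrange equation -/

section

variable {m : ℕ} {f : Plane → ℝ}

theorem ae_eq_zero_of_forall_test {v : Plane → ℝ} (hv : Integrable v discMeasure)
    (h : ∀ φ : 𝓓(disc, ℝ), ∫ x, v x * φ x ∂discMeasure = 0) : ∀ᵐ x ∂discMeasure, v x = 0 := by
  refine (ae_restrict_iff' measurableSet_disc).2
    (disc.isOpen.ae_eq_zero_of_integral_contDiff_smul_eq_zero
      (IntegrableOn.locallyIntegrableOn hv) fun g hg hgc hgs => ?_)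
  have h1 := h ⟨g, hg, hgc, hgs⟩
  rw [← setIntegral_disc_eq fun x hx => by
    simp [image_eq_zero_of_notMem_tsupport fun hx' => hx (hgs hx')]]
  rw [← h1]
  exact integral_congr_ae (.of_forall fun x => mul_comm _ _)

/-- The matrix `∂_α Q Qᵀ` is skew, by the weak Leibniz rule applied to `Q Qᵀ = 1`. -/
theorem IsAdmissible.grad_mul_transpose_skew {Q : Plane → Matrix (Fin m) (Fin m) ℝ}
    {dQ : Plane → Fin 2 → Matrix (Fin m) (Fin m) ℝ} (h : IsAdmissible f Q dQ) :
    ∀ᵐ x ∂discMeasure, ∀ α,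
      (dQ x α * (Q x).transpose).transpose = -(dQ x α * (Q x).transpose) := by
  have hW := h.isW12SO.1
  have key : ∀ α i j, ∀ᵐ x ∂discMeasure,
      ∑ k, (dQ x α i k * Q x j k + Q x i k * dQ x α j k) = 0 := by
    intro α i j
    have hi : ∀ k, Integrable (fun x => dQ x α i k * Q x j k + Q x i k * dQ x α j k)
        discMeasure := fun k =>
      (integrable_mul_of_memLp_two ((hW i k).memLp_grad α) (hW j k).memLp).add
        (integrable_mul_of_memLp_two (hW i k).memLp ((hW j k).memLp_grad α))
    refine ae_eq_zero_of_forall_test (integrable_finsetSum _ fun k _ => hi k) fun φ => ?_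
    have hφ : ∀ {w : Plane → ℝ} (ψ : 𝓓(disc, ℝ)), Integrable w discMeasure →
        Integrable (fun x => w x * ψ x) discMeasure := by
      intro w ψ hw
      obtain ⟨C, hC⟩ := exists_bound_test ψ
      exact hw.mul_bdd (memLp_test ψ 2).1 (.of_forall hC)
    have h1 : ∀ k, ∫ x, (dQ x α i k * Q x j k + Q x i k * dQ x α j k) * φ x ∂discMeasure =
        -∫ x, Q x i k * Q x j k * partialDeriv α φ x ∂discMeasure := fun k => by
      rw [integral_mul_partialDeriv (h.boundary i k) (hW j k), neg_neg]
    have hJ : ∀ k, Integrable (fun x => Q x i k * Q x j k * partialDeriv α φ x) discMeasure :=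
      fun k => hφ (dTest α φ) (integrable_mul_of_memLp_two (hW i k).memLp (hW j k).memLp)
    simp only [Finset.sum_mul]
    rw [integral_finsetSum _ fun k _ => hφ φ (hi k)]
    simp only [h1]
    rw [Finset.sum_neg_distrib, ← integral_finsetSum _ fun k _ => hJ k, neg_eq_zero]
    calc _ = ∫ x, (1 : Matrix (Fin m) (Fin m) ℝ) i j * partialDeriv α φ x ∂discMeasure := by
          refine integral_congr_ae ?_
          filter_upwards [h.isW12SO.2] with x hx
          rw [← mul_transpose_self_of_mem hx, Matrix.mul_apply, Finset.sum_mul]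
          rfl
      _ = 0 := by rw [integral_const_mul, integral_partialDeriv_test, mul_zero]
  filter_upwards [ae_all_iff.2 fun α => ae_all_iff.2 fun i => ae_all_iff.2 fun j => key α i j]
    with x hx α
  ext i j
  have := hx α i j
  rw [Finset.sum_add_distrib] at this
  simp only [Matrix.transpose_apply, Matrix.neg_apply, Matrix.mul_apply]
  have e : ∑ k, dQ x α j k * Q x i k = ∑ k, Q x i k * dQ x α j k :=
    Finset.sum_congr rfl fun k _ => mul_comm _ _
  rw [e]
  linarith

/-- The Frobenius product of `X` with `(E_ij - E_ji) Q` is an off-diagonal difference of `X Qᵀ`. -/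
theorem sum_mul_skewUnit (X Q : Matrix (Fin m) (Fin m) ℝ) (i j : Fin m) :
    ∑ k, ∑ l, X k l * (skewUnit i j * Q) k l =
      (X * Q.transpose) i j - (X * Q.transpose) j i := by
  have h : ∀ a b : Fin m, ∑ k, ∑ l, X k l * (Matrix.single a b (1 : ℝ) * Q) k l =
      (X * Q.transpose) a b := by
    intro a b
    rw [Finset.sum_eq_single a]
    · simp [Matrix.mul_apply, Matrix.single_apply]
    · intro k _ hk
      refine Finset.sum_eq_zero fun l _ => ?_
      rw [Matrix.single_mul_apply_of_ne _ _ _ _ _ hk, mul_zero]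
    · simp
  rw [← h i j, ← h j i, ← Finset.sum_sub_distrib]
  refine Finset.sum_congr rfl fun k _ => ?_
  rw [← Finset.sum_sub_distrib]
  refine Finset.sum_congr rfl fun l _ => ?_
  rw [skewUnit, sub_mul, Matrix.sub_apply, mul_sub]

/-- The Euler-Lagrange equation of the gauge energy. Variations in the direction `E_ij - E_ji` only
see the skew part of `V = (Q Ω - ∇Q) Qᵀ`, which is all of `V`: the first term is conjugate to `Ω`,
and the second is skew because `Q Qᵀ = 1`. -/
theorem divEqZero_of_minimizer (hf : Integrable f discMeasure)
    (hf1 : ∀ᵐ x ∂discMeasure, 1 ≤ f x) {Ω : Plane → Fin 2 → Matrix (Fin m) (Fin m) ℝ}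
    (hΩ : ∀ α i j, MemLp (fun x => √(f x) * Ω x α i j) 2 discMeasure)
    (hso : ∀ᵐ x ∂discMeasure, ∀ α, Ω x α ∈ LieAlgebra.Orthogonal.so (Fin m) ℝ)
    {Q : Plane → Matrix (Fin m) (Fin m) ℝ}
    {dQ : Plane → Fin 2 → Matrix (Fin m) (Fin m) ℝ} (h : IsAdmissible f Q dQ)
    (hmin : gaugeEnergy f Ω Q dQ = gaugeInf f Ω) :
    DivEqZero (fun x α => f x • (Q x * Ω x α * (Q x)⁻¹ - dQ x α * (Q x)⁻¹)) := by
  have hQt := h.isW12SO.memLp_top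
  have hX := memLp_sqrt_mul_gauge hQt hΩ (h.memLp_sqrt_mul hf.1 hf1)
  -- on `SO(m)` the inverse is the transpose
  have hV : ∀ᵐ x ∂discMeasure, ∀ α,
      f x • (Q x * Ω x α * (Q x)⁻¹ - dQ x α * (Q x)⁻¹) =
        f x • ((Q x * Ω x α - dQ x α) * (Q x).transpose) := by
    filter_upwards [h.isW12SO.2] with x hx α
    rw [Matrix.inv_eq_left_inv (transpose_mul_self_of_mem hx), sub_mul]
  have hskew : ∀ᵐ x ∂discMeasure, ∀ α, ((Q x * Ω x α - dQ x α) * (Q x).transpose).transpose =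
      -((Q x * Ω x α - dQ x α) * (Q x).transpose) := by
    filter_upwards [hso, h.grad_mul_transpose_skew] with x h1 h2 α
    rw [sub_mul, Matrix.transpose_sub, h2 α, Matrix.transpose_mul, Matrix.transpose_mul,
      (LieAlgebra.Orthogonal.mem_so (n := Fin m) (R := ℝ) _).1 (h1 α), Matrix.transpose_transpose]
    noncomm_ring
  have hint : ∀ α i j, Integrable
      (fun x => f x * ((Q x * Ω x α - dQ x α) * (Q x).transpose) i j) discMeasure := by
    intro α i j
    have h1 : Integrable (fun x => ∑ l, √(f x) *
        (Q x j l * (√(f x) * (Q x * Ω x α - dQ x α) i l))) discMeasure :=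
      integrable_finsetSum _ fun l _ => integrable_mul_of_memLp_two (memLp_sqrt hf hf1)
        ((hX α i l).mul (hQt j l))
    refine h1.congr ?_
    filter_upwards [hf1] with x hx
    rw [Matrix.mul_apply, Finset.mul_sum]
    refine Finset.sum_congr rfl fun l _ => ?_
    rw [Matrix.transpose_apply]
    nth_rewrite 3 [← Real.mul_self_sqrt (zero_le_one.trans hx)]
    ring
  refine ⟨fun α i j => IntegrableOn.locallyIntegrableOn ((hint α i j).congr ?_), fun i j φ => ?_⟩
  · filter_upwards [hV] with x hx
    rw [hx α]
    rfl
  · have h1 := first_variation hf hf1 hΩ h hmin (skewUnit_cube i j) (transpose_skewUnit i j) φ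
    have hY : ∀ α i' j', MemLp (fun x => √(f x) * (partialDeriv α φ x *
        (skewUnit i j * Q x) i' j')) 2 discMeasure := fun α i' j' =>
      memLp_sqrt_mul_partialDeriv hf hf1 (memLp_top_matrix_mul (P := fun _ => skewUnit i j)
        (fun _ _ => memLp_const _) hQt i' j') φ α
    rw [← integral_finsetSum _ fun p _ => integrable_mul_of_memLp_two (hX p.1 p.2.1 p.2.2)
      (hY p.1 p.2.1 p.2.2)] at h1
    have h2 : ∫ x, 2 * ∑ α, (f x • (Q x * Ω x α * (Q x)⁻¹ - dQ x α * (Q x)⁻¹)) i j *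
        partialDeriv α φ x ∂discMeasure = 0 := by
      rw [← h1]
      refine integral_congr_ae ?_
      filter_upwards [hV, hskew, hf1] with x hVx hsx hx
      have h3 : ∀ α, ∑ k, ∑ l, (Q x * Ω x α - dQ x α) k l * (skewUnit i j * Q x) k l =
          2 * ((Q x * Ω x α - dQ x α) * (Q x).transpose) i j := by
        intro α
        rw [sum_mul_skewUnit]
        have := congrFun (congrFun (hsx α) i) j
        rw [Matrix.transpose_apply, Matrix.neg_apply] at this
        rw [this]
        ring
      have h4 : ∀ α k l, √(f x) * (Q x * Ω x α - dQ x α) k l *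
          (√(f x) * (partialDeriv α φ x * (skewUnit i j * Q x) k l)) =
          f x * partialDeriv α φ x *
            ((Q x * Ω x α - dQ x α) k l * (skewUnit i j * Q x) k l) := by
        intro α k l
        nth_rewrite 3 [← Real.mul_self_sqrt (zero_le_one.trans hx)]
        ring
      simp only [Fintype.sum_prod_type, h4, ← Finset.mul_sum, h3]
      rw [Finset.mul_sum]
      refine Finset.sum_congr rfl fun α _ => ?_
      rw [hVx α, Matrix.smul_apply, smul_eq_mul]
      ring
    rw [integral_const_mul] at h2
    exact (mul_eq_zero.1 h2).resolve_left two_ne_zero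

/-- The exponent `p / (p - 2)` exceeds `1`, so a weight in that space has finite mass. -/
theorem integrable_of_memLp_conjugate {p : ℝ} (hp : 2 < p)
    (hf : MemLp f (ENNReal.ofReal (p / (p - 2))) discMeasure) : Integrable f discMeasure := by
  refine hf.integrable ?_
  rw [ENNReal.one_le_ofReal, one_le_div (by linarith)]
  linarith

end

end GaugeExtraction

theorem lemma2p1 (m : ℕ) (p : ℝ) (hp : 2 < p)
    (f : GaugeExtraction.Plane → ℝ)
    (hf : MemLp f (ENNReal.ofReal (p / (p - 2))) GaugeExtraction.discMeasure)
    (hf1 : ∀ᵐ x ∂GaugeExtraction.discMeasure, 1 ≤ f x)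
    (Ω : GaugeExtraction.Plane → Fin 2 → Matrix (Fin m) (Fin m) ℝ)
    (hΩ : GaugeExtraction.IsL2so Ω)
    (hfΩ : GaugeExtraction.weightedEnergy f Ω < ⊤) :
    ∃ (Q : GaugeExtraction.Plane → Matrix (Fin m) (Fin m) ℝ)
      (dQ : GaugeExtraction.Plane → Fin 2 → Matrix (Fin m) (Fin m) ℝ),
      GaugeExtraction.IsAdmissible f Q dQ ∧
      GaugeExtraction.gaugeEnergy f Ω Q dQ = GaugeExtraction.gaugeInf f Ω ∧
      GaugeExtraction.DivEqZero
        (fun x α => f x • (Q x * Ω x α * (Q x)⁻¹ - dQ x α * (Q x)⁻¹)) ∧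
      GaugeExtraction.gaugeEnergy f Ω Q dQ ≤ GaugeExtraction.weightedEnergy f Ω := by
  have hfi := GaugeExtraction.integrable_of_memLp_conjugate hp hf
  have hΩ' := GaugeExtraction.memLp_of_weightedEnergy_lt_top hfi.1 hf1
    (fun α i j => (hΩ.1 α i j).1) hfΩ
  obtain ⟨Q, dQ, hadm, hmin⟩ := GaugeExtraction.exists_minimizer hfi.1 hf1 hΩ'
  exact ⟨Q, dQ, hadm, hmin,
    GaugeExtraction.divEqZero_of_minimizer hfi hf1 hΩ' hΩ.2 hadm hmin,
    hmin.trans_le (GaugeExtraction.gaugeInf_le_weightedEnergy Ω)⟩
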